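/- Let $V$ be a real separable Banach space, $T\ge 0$ an integer and $I=\{0,1,\dots,T\}$. An adapted process $\mathbf X=(\Omega,\mathbb P,(\mathcal F_t)_{t\in I},X)\in\mathcal S(V)$ consists of a filtered probability space and random variables $X_t:\Omega\to V$, $t\in I$, with $X_t$ $\mathcal F_t$-measurable; different processes may live on different spaces. *Adapted functionals.* They are the maps $f$, sending each $\mathbf X\in\mathcal S(V)$ to a real random variable $f(\mathbf X)$, that are generated by the following rules: (a) $\mathbf X\mapsto g(X_{t_1},\dots,X_{t_n})$ with $t_i\in I$, $g\in C_b(V^n,\mathbb R)$, of rank $0$; (b) $\mathbf X\mapsto g(f_1(\mathbf X),\dots,f_n(\mathbf X))$ with $g\in C_b(\mathbb R^n,\mathbb R)$, of rank $\max_i\operatorname{rank}f_i$; (c) $\mathbf X\mapsto\mathbb E[f(\mathbf X)\mid\mathcal F_t]$ with $t\in I$, of rank $\operatorname{rank}f+1$. $\mathrm{AF}_r$ is the set of those that have a construction of rank at most $r$. *Prediction processes.* Put $\mathrm{Prob}_0(V)=V$ and $\mathrm{Prob}_{r+1}(V)=\mathrm{Prob}(I\to\mathrm{Prob}_r(V))$,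 with the weak topologies and their Borel $\sigma$-algebras. Let $\hat X^0=X$ and $\hat X^{r+1}_t=\mathbb P(\hat X^r\in\cdot\mid\mathcal F_t)$ (regular conditional distribution), so that $\operatorname{Law}(\hat X^r)\in\mathrm{Prob}_{r+1}(V)$. *Signatures.* For a Banach space $E$ give $\mathbb R\oplus E$ the norm $|s|+\|v\|$, and let its algebraic tensor powers carry admissible norms, i.e. norms that extend $|\cdot|$ in degree $0$ and the given norm in degree $1$, are invariant under permutation of the factors of elementary tensors, satisfy $\|s\otimes t\|\le\|s\|\,\|t\|$, and make all products $\ell_1\otimes\cdots\otimes\ell_m$ of continuous linear functionals continuous (for example the projective or the injective norms). Let $\mathbf T(E)$ be the completion of $\bigoplus_{m\ge0}(\mathbb R\oplus E)^{\otimes m}$ under $\|t\|=\sum_m\|t_m\|$. The signature of $x:I\to E$ is $S(x)=\exp(\Delta_0x)\cdot\exp(\Delta_1x)\cdots\exp(\Delta_Tx)\in\mathbf T(E)$, where $\exp(v)=(v^{\otimes m}/m!)_{m\ge0}$, $(s\cdot t)_m=\sum_{i+j=m}s_i\otimes t_j$, $\Delta_0x=(1,x(0))$ and $\Delta_tx=(1,x(t)-x(t-1))$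 for $t\ge1$. A tensor normalization on $\mathbf T(E)$ is a bounded, continuous, injective map $\Lambda:\{t\in\mathbf T(E):t_0=1\}\to\mathbf T(E)$ of the form $\Lambda(t)=(\lambda(t)^mt_m)_{m\ge0}$ with $\lambda(t)\in(0,\infty)$. Let $\mathbf T^0(V)=V$ and $\mathbf T^{r+1}(V)=\mathbf T(\mathbf T^r(V))$, and fix any tensor normalization $\Lambda_{r}$ on each $\mathbf T(\mathbf T^{r}(V))$, $r\ge0$. The robust expected signatures $\bar S^r:\mathrm{Prob}_r(V)\to\mathbf T^r(V)$ are $\bar S^0=\mathrm{id}_V$ and the Bochner integrals $$\bar S^{r+1}(\mu)=\int\Lambda_r\big(S(t\mapsto\bar S^r(x(t)))\big)\,\mu(dx).$$ Finally let $\Phi_r(\mathbf X)=\bar S^{r+1}(\operatorname{Law}(\hat X^r))\in\mathbf T^{r+1}(V)$. **Theorem.** For any such choice of admissible norms and tensor normalizations, all $\mathbf X,\mathbf Y\in\mathcal S(V)$ and every $r\ge0$, the following are equivalent: 1. $\mathbb E[f(\mathbf X)]=\mathbb E[f(\mathbf Y)]$ for all $f\in\mathrm{AF}_r$; 2. $\operatorname{Law}(\hat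 X^r)=\operatorname{Law}(\hat Y^r)$; 3. $\operatorname{Law}(\hat X^0,\dots,\hat X^r)=\operatorname{Law}(\hat Y^0,\dots,\hat Y^r)$; 4. $\Phi_r(\mathbf X)=\Phi_r(\mathbf Y)$. -/

import Mathlib

open MeasureTheory ProbabilityTheory Set Filter Topology
open scoped TensorProduct BoundedContinuousFunction

universe u v w

noncomputable section

/-! ### Probability measures on a standard Borel space form a standard Borel space -/

theorem standardBorelSpace_of_measurableEquiv {α β : Type*} [MeasurableSpace α] [MeasurableSpace β]
    [h : StandardBorelSpace β] (e : α ≃ᵐ β) : StandardBorelSpace α := by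
  obtain ⟨τ, hb, hp⟩ := h.polish
  refine ⟨⟨TopologicalSpace.induced e τ, ?_, ?_⟩⟩
  · refine @BorelSpace.mk _ (_) _ ?_
    rw [borel_comap, ← hb.measurable_eq]
    exact e.measurableEmbedding.comap_eq.symm
  · exact e.toEquiv.polishSpace_induced

open scoped Classical in
theorem standardBorelSpace_probabilityMeasure (α : Type*) [MeasurableSpace α]
    [StandardBorelSpace α] [Nonempty α] : StandardBorelSpace (ProbabilityMeasure α) := by
  have he := measurableEmbedding_embeddingReal α
  set e := embeddingReal α with he_def
  let F : ProbabilityMeasure α → ℚ → ℝ := fun μ q ↦ (μ : Measure α).real (e ⁻¹' Iic (q : ℝ))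
  have hF : Measurable F := by
    refine measurable_pi_lambda _ fun q ↦ ?_
    exact ((Measure.measurable_coe (he.measurable measurableSet_Iic)).comp
      measurable_subtype_coe).ennreal_toReal
  let S : (ℚ → ℝ) → Measure ℝ := fun f ↦ (stieltjesOfMeasurableRat id measurable_id f).measure
  have hS : Measurable S := measurable_measure_stieltjesOfMeasurableRat measurable_id
  let C : (ℚ → ℝ) → Measure α := fun f ↦ (S f).comap e
  have hC : Measurable C := by
    refine Measure.measurable_of_measurable_coe _ fun s hs ↦ ?_
    simp only [C, he.comap_apply]
    exact (Measure.measurable_coe (he.measurableSet_image.2 hs)).comp hS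
  have hP : MeasurableSet {f | IsProbabilityMeasure (C f)} :=
    hC ProbabilityMeasure.measurableSet_isProbabilityMeasure
  let x₀ : α := Classical.arbitrary α
  let G₀ : (ℚ → ℝ) → Measure α := fun f ↦ if IsProbabilityMeasure (C f) then C f else Measure.dirac x₀
  have hG₀p : ∀ f, IsProbabilityMeasure (G₀ f) := by
    intro f
    simp only [G₀]
    split_ifs with h
    · exact h
    · infer_instance
  have hG₀ : Measurable G₀ := Measurable.ite hP hC measurable_const
  let G : (ℚ → ℝ) → ProbabilityMeasure α := fun f ↦ ⟨G₀ f, hG₀p f⟩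
  have hG : Measurable G := hG₀.subtype_mk
  have hGF : Function.LeftInverse G F := by
    intro μ
    let ν : Measure ℝ := (μ : Measure α).map e
    have hν : IsProbabilityMeasure ν := Measure.isProbabilityMeasure_map he.measurable.aemeasurable
    have hFc : ∀ q : ℚ, F μ q = cdf ν q := by
      intro q
      rw [cdf_eq_real, measureReal_def, he.map_apply, ← measureReal_def]
    have hpt : IsRatStieltjesPoint (id : (ℚ → ℝ) → ℚ → ℝ) (F μ) := by
      refine ⟨?_, ?_, ?_, ?_⟩
      · intro a b hab
        simp only [id, hFc]
        exact monotone_cdf ν (by exact_mod_cast hab)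
      · have : (id (F μ) : ℚ → ℝ) = fun q : ℚ ↦ cdf ν q := funext hFc
        rw [this]
        exact (tendsto_cdf_atTop ν).comp (tendsto_ratCast_atTop_iff.2 tendsto_id)
      · have : (id (F μ) : ℚ → ℝ) = fun q : ℚ ↦ cdf ν q := funext hFc
        rw [this]
        exact (tendsto_cdf_atBot ν).comp (tendsto_ratCast_atBot_iff.2 tendsto_id)
      · intro t
        simp only [id, hFc]
        rw [← StieltjesFunction.iInf_rat_gt_eq (cdf ν) (t : ℝ)]
        refine Equiv.iInf_congr (Equiv.subtypeEquivRight fun q ↦ ?_) fun q ↦ rfl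
        exact Rat.cast_lt.symm
    have hSν : S (F μ) = ν := by
      refine ext_of_generate_finite _ (BorelSpace.measurable_eq.trans
        Real.borel_eq_generateFrom_Iic_rat) Real.isPiSystem_Iic_rat ?_ ?_
      · intro s hs
        obtain ⟨q, rfl⟩ := mem_iUnion.1 hs
        simp only [S]
        rw [measure_stieltjesOfMeasurableRat_Iic, stieltjesOfMeasurableRat_eq,
          toRatCDF_of_isRatStieltjesPoint hpt, id, hFc, ofReal_cdf]
      · simp [S]
    have hCμ : C (F μ) = μ := by
      simp only [C, hSν]
      exact he.comap_map _
    apply Subtype.ext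
    change G₀ (F μ) = μ
    have hp : IsProbabilityMeasure (C (F μ)) := hCμ ▸ μ.2
    simp only [G₀, if_pos hp, hCμ]
  have hr : MeasurableSet (range F) := by
    have : range F = {f | F (G f) = f} := by
      ext f
      constructor
      · rintro ⟨μ, rfl⟩
        exact congrArg F (hGF μ)
      · intro h
        exact ⟨G f, h⟩
    rw [this]
    exact measurableSet_eq_fun (hF.comp hG) measurable_id
  have hE : MeasurableEmbedding F := .of_measurable_inverse hF hr hG hGF
  have := hr.standardBorel
  exact standardBorelSpace_of_measurableEquiv hE.equivRange

/-! ### Adapted processes -/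

/-- An adapted stochastic process in discrete time `{0, …, T}` with state space `U`: a filtered
probability space together with an adapted family of random variables. -/
structure AdaptedProcess (T : ℕ) (U : Type u) [MeasurableSpace U] where
  Ω : Type v
  mΩ : MeasurableSpace Ω
  P : Measure Ω
  isProbabilityMeasure : IsProbabilityMeasure P
  ℱ : Filtration (Fin (T + 1)) mΩ
  X : Fin (T + 1) → Ω → U
  adapted : ∀ t, Measurable[ℱ t] (X t)

attribute [instance] AdaptedProcess.mΩ AdaptedProcess.isProbabilityMeasure

/-! ### Adapted functionals -/

/-- Adapted functionals, given by their construction: bounded continuous functions of finitely many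
marginals, bounded continuous functions of finitely many adapted functionals, and conditional
expectations of adapted functionals. -/
inductive AdaptedFunctional (T : ℕ) (U : Type u) [TopologicalSpace U] : Type u
  | marginal (n : ℕ) (t : Fin n → Fin (T + 1)) (g : (Fin n → U) →ᵇ ℝ) : AdaptedFunctional T U
  | comp (n : ℕ) (g : (Fin n → ℝ) →ᵇ ℝ) (f : Fin n → AdaptedFunctional T U) :
      AdaptedFunctional T U
  | condExp (t : Fin (T + 1)) (f : AdaptedFunctional T U) : AdaptedFunctional T U

namespace AdaptedFunctional

variable {T : ℕ} {U : Type u} [TopologicalSpace U]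

/-- The number of nested conditional expectations. -/
def rank : AdaptedFunctional T U → ℕ
  | marginal _ _ _ => 0
  | comp _ _ f => Finset.univ.sup fun i => (f i).rank
  | condExp _ f => f.rank + 1

/-- The random variable `f(X)`, well defined up to almost sure equality. -/
def eval [MeasurableSpace U] (X : AdaptedProcess.{u, v} T U) :
    AdaptedFunctional T U → X.Ω → ℝ
  | marginal _ t g => fun ω => g fun i => X.X (t i) ω
  | comp _ g f => fun ω => g fun i => (f i).eval X ω
  | condExp t f => X.P[f.eval X | X.ℱ t]

end AdaptedFunctional

/-! ### Probability measures of higher rank and prediction processes -/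

section Prediction

variable (T : ℕ) (V : Type u) [MeasurableSpace V]

/-- Recursive construction of `RankProb` together with its σ-algebra. -/
def rankProbAux : ℕ → Σ α : Type u, MeasurableSpace α
  | 0 => ⟨V, inferInstance⟩
  | r + 1 =>
    letI : MeasurableSpace (rankProbAux r).1 := (rankProbAux r).2
    ⟨ProbabilityMeasure (Fin (T + 1) → (rankProbAux r).1), inferInstance⟩

/-- Rank `r` probability measures on `V`: `Prob_0(V) = V` and
`Prob_{r+1}(V) = Prob({0,…,T} → Prob_r(V))`. -/
def RankProb (r : ℕ) : Type u := (rankProbAux T V r).1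

/-- The σ-algebra on `Prob_{r+1}(V)` is generated by the evaluations `μ ↦ μ(B)`, `B` measurable;
for Polish `V` it is the Borel σ-algebra of the weak topology. -/
instance (r : ℕ) : MeasurableSpace (RankProb T V r) := (rankProbAux T V r).2

theorem rankProb_succ (r : ℕ) :
    RankProb T V (r + 1) = ProbabilityMeasure (Fin (T + 1) → RankProb T V r) := rfl

variable [StandardBorelSpace V] [Nonempty V]

theorem rankProb_nonempty_and_standardBorel (r : ℕ) :
    Nonempty (RankProb T V r) ∧ StandardBorelSpace (RankProb T V r) := by
  induction r with
  | zero => exact ⟨‹Nonempty V›, ‹StandardBorelSpace V›⟩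
  | succ r ih =>
    obtain ⟨h1, h2⟩ := ih
    refine ⟨?_, standardBorelSpace_probabilityMeasure (Fin (T + 1) → RankProb T V r)⟩
    exact ⟨(⟨Measure.dirac (Classical.arbitrary _), inferInstance⟩ :
      ProbabilityMeasure (Fin (T + 1) → RankProb T V r))⟩

instance (r : ℕ) : Nonempty (RankProb T V r) := (rankProb_nonempty_and_standardBorel T V r).1

instance (r : ℕ) : StandardBorelSpace (RankProb T V r) :=
  (rankProb_nonempty_and_standardBorel T V r).2

end Prediction

/-- The regular conditional distribution `P(Y ∈ · | m)`, as a random probability measure. -/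
def condLaw {Ω E : Type*} [mΩ : MeasurableSpace Ω] [MeasurableSpace E] [StandardBorelSpace E]
    [Nonempty E] (P : Measure Ω) [IsProbabilityMeasure P] (m : MeasurableSpace Ω) (Y : Ω → E)
    (ω : Ω) : ProbabilityMeasure E :=
  ⟨@condDistrib Ω Ω E _ _ _ mΩ m Y id P _ ω, inferInstance⟩

theorem measurable_condLaw {Ω E : Type*} [mΩ : MeasurableSpace Ω] [MeasurableSpace E]
    [StandardBorelSpace E] [Nonempty E] (P : Measure Ω) [IsProbabilityMeasure P]
    (m : MeasurableSpace Ω) (Y : Ω → E) : Measurable[m] (condLaw (mΩ := mΩ) P m Y) :=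
  @Measurable.subtype_mk Ω (Measure E) m _ _ _
    (@Kernel.measurable Ω E m _ (@condDistrib Ω Ω E _ _ _ mΩ m Y id P _)) _

namespace AdaptedProcess

variable {T : ℕ} {V : Type u} [MeasurableSpace V] [StandardBorelSpace V] [Nonempty V]

/-- The rank `r` prediction process. -/
def prediction (X : AdaptedProcess.{u, v} T V) :
    (r : ℕ) → X.Ω → Fin (T + 1) → RankProb T V r
  | 0 => fun ω t => X.X t ω
  | r + 1 => fun ω t =>
    (condLaw X.P (X.ℱ t) (X.prediction r) ω :
      ProbabilityMeasure (Fin (T + 1) → RankProb T V r))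

theorem measurable_prediction (X : AdaptedProcess.{u, v} T V) (r : ℕ) :
    Measurable (X.prediction r) := by
  refine measurable_pi_lambda _ fun t => ?_
  cases r with
  | zero => exact (X.adapted t).mono (X.ℱ.le t) le_rfl
  | succ r => exact (measurable_condLaw X.P (X.ℱ t) (X.prediction r)).mono (X.ℱ.le t) le_rfl

/-- The law of the rank `r` prediction process, an element of `Prob_{r+1}(V)`. -/
def predictionLaw (X : AdaptedProcess.{u, v} T V) (r : ℕ) : RankProb T V (r + 1) :=
  (⟨X.P.map (X.prediction r),
    Measure.isProbabilityMeasure_map (X.measurable_prediction r).aemeasurable⟩ :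
    ProbabilityMeasure (Fin (T + 1) → RankProb T V r))

/-- The joint law of the prediction processes of ranks `0, …, r`. -/
def jointPredictionLaw (X : AdaptedProcess.{u, v} T V) (r : ℕ) :
    Measure ((i : Fin (r + 1)) → Fin (T + 1) → RankProb T V i) :=
  X.P.map fun ω i => X.prediction i ω

end AdaptedProcess

/-! ### Tensor sequences: exponential, convolution product, discrete signature -/

section TensorSequences

variable {F : Type*} [AddCommGroup F] [Module ℝ F]

/-- The unit of `∏ₘ F^{⊗m}`. -/
def tensorOne : (m : ℕ) → ⨂[ℝ]^m F
  | 0 => PiTensorProduct.tprod ℝ Fin.elim0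
  | _ + 1 => 0

/-- The tensor exponential `(v^{⊗m} / m!)ₘ`. -/
def tensorExp (v : F) (m : ℕ) : ⨂[ℝ]^m F :=
  (m.factorial : ℝ)⁻¹ • PiTensorProduct.tprod ℝ fun _ : Fin m => v

/-- The tensor convolution product `(s · t)ₘ = ∑_{i+j=m} sᵢ ⊗ tⱼ`. -/
def tensorConv (s t : (m : ℕ) → ⨂[ℝ]^m F) (m : ℕ) : ⨂[ℝ]^m F :=
  ∑ p ∈ (Finset.HasAntidiagonal.antidiagonal m).attach,
    TensorPower.cast ℝ F (Finset.HasAntidiagonal.mem_antidiagonal.1 p.2)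
      (GradedMonoid.GMul.mul (A := fun i => ⨂[ℝ]^i F) (s p.1.1) (t p.1.2))

end TensorSequences

/-- The direct sum `ℝ ⊕ E` with norm `|s| + ‖v‖`. -/
abbrev TimeExt (E : Type*) : Type _ := WithLp 1 (ℝ × E)

/-- Increments of the time-extended path: `Δ₀x = (1, x(0))`, `Δₜx = (1, x(t) - x(t-1))`. -/
def timeIncrement {T : ℕ} {E : Type*} [NormedAddCommGroup E] (x : Fin (T + 1) → E)
    (t : Fin (T + 1)) : TimeExt E :=
  WithLp.toLp 1
    ((1 : ℝ), Fin.cases (motive := fun _ => E) (x 0) (fun s => x s.succ - x s.castSucc) t)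

/-- The discrete signature `exp(Δ₀x) · exp(Δ₁x) ⋯ exp(Δ_T x)`, as a sequence of tensors. -/
def signatureSeq {T : ℕ} {E : Type*} [NormedAddCommGroup E] [NormedSpace ℝ E]
    (x : Fin (T + 1) → E) : (m : ℕ) → ⨂[ℝ]^m (TimeExt E) :=
  (List.ofFn fun t => tensorExp (timeIncrement x t)).foldr tensorConv tensorOne

/-! ### Norms on tensor powers and the completed tensor algebra -/

/-- Admissible norms on the tensor powers of a normed space: they are invariant under permutation
of the factors of an elementary tensor and submultiplicative, agree with the given norm in degree
one (and with the absolute value in degree zero), and the products `ℓ₁ ⊗ ⋯ ⊗ ℓₘ` of continuous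
functionals are continuous. As the latter separate points, each `norm m` is positive definite. -/
structure AdmissibleNorm (F : Type*) [NormedAddCommGroup F] [NormedSpace ℝ F] where
  norm : (m : ℕ) → Seminorm ℝ (⨂[ℝ]^m F)
  norm_unit : norm 0 (PiTensorProduct.tprod ℝ Fin.elim0) = 1
  norm_single : ∀ v : F, norm 1 (PiTensorProduct.tprod ℝ fun _ => v) = ‖v‖
  norm_perm : ∀ (m : ℕ) (σ : Equiv.Perm (Fin m)) (v : Fin m → F),
    norm m (PiTensorProduct.tprod ℝ fun i => v (σ i)) = norm m (PiTensorProduct.tprod ℝ v)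
  norm_mul_le : ∀ (m n : ℕ) (s : ⨂[ℝ]^m F) (t : ⨂[ℝ]^n F),
    norm (m + n) (GradedMonoid.GMul.mul (A := fun i => ⨂[ℝ]^i F) s t) ≤ norm m s * norm n t
  continuous_functional : ∀ (m : ℕ) (ℓ : Fin m → StrongDual ℝ F), ∃ C : ℝ, ∀ t : ⨂[ℝ]^m F,
    |PiTensorProduct.lift ((MultilinearMap.mkPiAlgebra ℝ (Fin m) ℝ).compLinearMap
      fun i => (ℓ i).toLinearMap) t| ≤ C * norm m t

section CompletedTensorAlgebra

variable {F : Type u} [NormedAddCommGroup F] [NormedSpace ℝ F]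

/-- The algebraic tensor power `F^{⊗m}`, carrying the norm from `N`. -/
def NormedTensorPower (_N : AdmissibleNorm F) (m : ℕ) : Type u := ⨂[ℝ]^m F

instance (N : AdmissibleNorm F) (m : ℕ) : AddCommGroup (NormedTensorPower N m) :=
  inferInstanceAs (AddCommGroup (⨂[ℝ]^m F))

instance (N : AdmissibleNorm F) (m : ℕ) : Module ℝ (NormedTensorPower N m) :=
  inferInstanceAs (Module ℝ (⨂[ℝ]^m F))

instance (N : AdmissibleNorm F) (m : ℕ) : SeminormedAddCommGroup (NormedTensorPower N m) :=
  AddGroupSeminorm.toSeminormedAddCommGroup (E := NormedTensorPower N m)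
    (N.norm m).toAddGroupSeminorm

theorem NormedTensorPower.norm_def (N : AdmissibleNorm F) (m : ℕ) (t : NormedTensorPower N m) :
    ‖t‖ = N.norm m t := rfl

instance (N : AdmissibleNorm F) (m : ℕ) : NormedSpace ℝ (NormedTensorPower N m) where
  norm_smul_le c t := (map_smul_eq_mul (N.norm m) c t).le

/-- The completed tensor power. -/
abbrev CompletedTensorPower (N : AdmissibleNorm F) (m : ℕ) : Type u :=
  UniformSpace.Completion (NormedTensorPower N m)

/-- An algebraic tensor, viewed in the completed tensor power. -/
def toCompletedTensorPower (N : AdmissibleNorm F) (m : ℕ) (t : ⨂[ℝ]^m F) :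
    CompletedTensorPower N m :=
  UniformSpace.Completion.coe' (α := NormedTensorPower N m) t

/-- The completion of `⨁ₘ F^{⊗m}` with respect to the norm `∑ₘ ‖tₘ‖`. -/
abbrev CompletedTensorAlgebra (N : AdmissibleNorm F) : Type u :=
  lp (fun m => CompletedTensorPower N m) 1

theorem norm_toCompletedTensorPower (N : AdmissibleNorm F) (m : ℕ) (t : ⨂[ℝ]^m F) :
    ‖toCompletedTensorPower N m t‖ = N.norm m t :=
  UniformSpace.Completion.norm_coe (E := NormedTensorPower N m) t

theorem AdmissibleNorm.norm_cast (N : AdmissibleNorm F) {i j : ℕ} (h : i = j) (t : ⨂[ℝ]^i F) :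
    N.norm j (TensorPower.cast ℝ F h t) = N.norm i t := by
  subst h
  simp

theorem AdmissibleNorm.norm_pow_le (N : AdmissibleNorm F) (v : F) (m : ℕ) :
    N.norm m (PiTensorProduct.tprod ℝ fun _ : Fin m => v) ≤ ‖v‖ ^ m := by
  induction m with
  | zero =>
    have : (fun _ : Fin 0 => v) = Fin.elim0 := funext fun i => i.elim0
    rw [this, N.norm_unit, pow_zero]
  | succ m ih =>
    have h : PiTensorProduct.tprod ℝ (fun _ : Fin (m + 1) => v) =
        GradedMonoid.GMul.mul (A := fun i => ⨂[ℝ]^i F)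
          (PiTensorProduct.tprod ℝ fun _ : Fin m => v)
          (PiTensorProduct.tprod ℝ fun _ : Fin 1 => v) := by
      rw [TensorPower.tprod_mul_tprod]
      congr 1
      funext i
      refine Fin.addCases (fun i => ?_) (fun i => ?_) i <;> simp
    rw [h, pow_succ]
    refine (N.norm_mul_le _ _ _ _).trans ?_
    rw [N.norm_single]
    exact mul_le_mul_of_nonneg_right ih (norm_nonneg v)

theorem AdmissibleNorm.summable_one (N : AdmissibleNorm F) :
    Summable fun m => N.norm m (tensorOne m) := by
  refine summable_of_ne_finset_zero (s := {0}) fun m hm => ?_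
  cases m with
  | zero => simp at hm
  | succ m => simp [tensorOne]

theorem AdmissibleNorm.summable_exp (N : AdmissibleNorm F) (v : F) :
    Summable fun m => N.norm m (tensorExp v m) := by
  refine Summable.of_nonneg_of_le (fun m => apply_nonneg _ _) (fun m => ?_)
    (Real.summable_pow_div_factorial ‖v‖)
  rw [tensorExp, map_smul_eq_mul, Real.norm_eq_abs, abs_of_nonneg (by positivity),
    div_eq_inv_mul]
  exact mul_le_mul_of_nonneg_left (N.norm_pow_le v m) (by positivity)

theorem AdmissibleNorm.summable_conv (N : AdmissibleNorm F) {s t : (m : ℕ) → ⨂[ℝ]^m F}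
    (hs : Summable fun m => N.norm m (s m)) (ht : Summable fun m => N.norm m (t m)) :
    Summable fun m => N.norm m (tensorConv s t m) := by
  have h := summable_sum_mul_antidiagonal_of_summable_norm'
    (f := fun m => N.norm m (s m)) (g := fun m => N.norm m (t m)) hs.norm hs ht.norm ht
  refine Summable.of_nonneg_of_le (fun m => apply_nonneg _ _) (fun m => ?_) h
  rw [tensorConv]
  conv_rhs => rw [← Finset.sum_attach]
  refine (Finset.le_sum_of_subadditive (N.norm m) (map_zero (N.norm m)).le
    (map_add_le_add (N.norm m)) _ _).trans (Finset.sum_le_sum fun p _ => ?_)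
  rw [N.norm_cast]
  exact N.norm_mul_le _ _ _ _

end CompletedTensorAlgebra

section Signature

variable {F : Type u} [NormedAddCommGroup F] [NormedSpace ℝ F]

theorem AdmissibleNorm.memℓp (N : AdmissibleNorm F) {s : (m : ℕ) → ⨂[ℝ]^m F}
    (hs : Summable fun m => N.norm m (s m)) :
    Memℓp (fun m => toCompletedTensorPower N m (s m)) 1 := by
  refine memℓp_gen ?_
  simpa [norm_toCompletedTensorPower] using hs

theorem AdmissibleNorm.summable_signatureSeq {T : ℕ} {E : Type u} [NormedAddCommGroup E]
    [NormedSpace ℝ E] (N : AdmissibleNorm (TimeExt E)) (x : Fin (T + 1) → E) :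
    Summable fun m => N.norm m (signatureSeq x m) := by
  have key : ∀ l : List (TimeExt E), Summable fun m =>
      N.norm m ((l.map tensorExp).foldr tensorConv tensorOne m) := by
    intro l
    induction l with
    | nil => exact N.summable_one
    | cons v l ih => exact N.summable_conv (N.summable_exp v) ih
  have h := key (List.ofFn (timeIncrement x))
  rwa [List.map_ofFn] at h

/-- The signature of a discrete-time path, in the completed tensor algebra over `ℝ ⊕ E`. -/
def signature {T : ℕ} {E : Type u} [NormedAddCommGroup E] [NormedSpace ℝ E]
    (N : AdmissibleNorm (TimeExt E)) (x : Fin (T + 1) → E) : CompletedTensorAlgebra N :=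
  ⟨fun m => toCompletedTensorPower N m (signatureSeq x m), N.memℓp (N.summable_signatureSeq x)⟩

/-- The elements of the completed tensor algebra with scalar component `1`. -/
def unitScalarPart (N : AdmissibleNorm F) : Set (CompletedTensorAlgebra N) :=
  {t | t 0 = toCompletedTensorPower N 0 (PiTensorProduct.tprod ℝ Fin.elim0)}

/-- A tensor normalization: a bounded, continuous, injective map `t ↦ δ_{λ(t)} t` with `λ(t) > 0`
on the tensors with scalar component `1`, where `δ_c` multiplies the `m`-th component by `c ^ m`.
Values of `toFun` and `scale` at other tensors are irrelevant. -/
structure TensorNormalization (N : AdmissibleNorm F) where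
  scale : CompletedTensorAlgebra N → ℝ
  toFun : CompletedTensorAlgebra N → CompletedTensorAlgebra N
  scale_pos : ∀ t ∈ unitScalarPart N, 0 < scale t
  apply_eq : ∀ t ∈ unitScalarPart N, ∀ m, toFun t m = scale t ^ m • t m
  bounded : ∃ K : ℝ, ∀ t ∈ unitScalarPart N, ‖toFun t‖ ≤ K
  continuousOn : ContinuousOn toFun (unitScalarPart N)
  injOn : InjOn toFun (unitScalarPart N)

end Signature

/-! ### Higher rank tensor algebras and robust expected signatures -/

/-- A choice of admissible tensor norms for every normed space. -/
abbrev TensorNormSystem : Type (u + 1) :=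
  (E : Type u) → [NormedAddCommGroup E] → [NormedSpace ℝ E] → AdmissibleNorm E

/-- A bundled real Banach space. -/
structure BanachBundle : Type (u + 1) where
  carrier : Type u
  [normed : NormedAddCommGroup carrier]
  [space : NormedSpace ℝ carrier]
  [complete : CompleteSpace carrier]

attribute [instance] BanachBundle.normed BanachBundle.space BanachBundle.complete

section HigherRank

variable (N : TensorNormSystem.{u}) (V : Type u) [NormedAddCommGroup V] [NormedSpace ℝ V]
  [CompleteSpace V]

/-- Recursive construction of `RankTensor` together with its norm. -/
def rankTensorAux : ℕ → BanachBundle.{u}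
  | 0 => ⟨V⟩
  | r + 1 => ⟨CompletedTensorAlgebra (N (TimeExt (rankTensorAux r).carrier))⟩

/-- The rank `r` tensor algebra: `T⁰(V) = V`, and `Tʳ⁺¹(V)` is the completed tensor algebra over
`ℝ ⊕ Tʳ(V)`. -/
def RankTensor (r : ℕ) : Type u := (rankTensorAux N V r).carrier

instance (r : ℕ) : NormedAddCommGroup (RankTensor N V r) := (rankTensorAux N V r).normed

instance (r : ℕ) : NormedSpace ℝ (RankTensor N V r) := (rankTensorAux N V r).space

instance (r : ℕ) : CompleteSpace (RankTensor N V r) := (rankTensorAux N V r).complete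

theorem rankTensor_succ (r : ℕ) :
    RankTensor N V (r + 1) = CompletedTensorAlgebra (N (TimeExt (RankTensor N V r))) := rfl

/-- A choice of tensor normalization on the tensor algebra of each rank `≥ 1`. -/
abbrev RankNormalization : Type u :=
  (r : ℕ) → TensorNormalization (N (TimeExt (RankTensor N V r)))

variable {N V}

/-- The robust expected signature of rank `r`: the identity for `r = 0`, and
`μ ↦ ∫ Λ(S(t ↦ expSigʳ(x(t)))) μ(dx)` for `r + 1`. -/
def robustExpSig {T : ℕ} [MeasurableSpace V] (L : RankNormalization N V) :
    (r : ℕ) → RankProb T V r → RankTensor N V r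
  | 0 => fun v => (show V from v)
  | r + 1 => fun μ =>
    (∫ x, (L r).toFun (signature (N (TimeExt (RankTensor N V r)))
        fun t => robustExpSig L r (x t))
      ∂((show ProbabilityMeasure (Fin (T + 1) → RankProb T V r) from μ :
        Measure (Fin (T + 1) → RankProb T V r))) :
      CompletedTensorAlgebra (N (TimeExt (RankTensor N V r))))

/-- The map `Φ_r`: the rank `r + 1` robust expected signature of the law of the rank `r`
prediction process. -/
def adaptedSig {T : ℕ} [MeasurableSpace V] [StandardBorelSpace V] [Nonempty V]
    (L : RankNormalization N V) (r : ℕ) (X : AdaptedProcess.{u, v} T V) :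
    RankTensor N V (r + 1) :=
  robustExpSig L (r + 1) (X.predictionLaw r)

end HigherRank

end

noncomputable section

/-! ### Conditional laws -/

section CondLaw

variable {Ω E : Type*} {m : MeasurableSpace Ω} [mΩ : MeasurableSpace Ω] [MeasurableSpace E]
  [StandardBorelSpace E] [Nonempty E] {P : Measure Ω} [IsProbabilityMeasure P] {Y : Ω → E}

/-! Everything is compared with condition 2, the equality of the laws of the rank `r` prediction
processes.

Joint laws: at the terminal time `T` the process `X̂^r` is already measurable, so `X̂^{r+1}_T` is
almost surely the Dirac mass at `X̂^r`. Reading off the atom is measurable, hence the lower ranks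
are measurable functions of `X̂^r`, the same functions for `X` and `Y`
(`exists_measurable_prediction_of_le`).

Adapted functionals: a conditional expectation given `ℱ t` is an integral against `X̂^{r+1}_t`, so a
functional of rank at most `r` is a bounded measurable function of `X̂^r` (`exists_representation`).
Conversely the representing functions are stable under bounded continuous operations and generate
the whole σ-algebra, by induction on `r`; a π-λ argument then recovers the law from their
expectations.

Signatures: condition 4 follows from injectivity of the robust expected signature
(`robustExpSig_injective`), again by induction on the rank. Words of continuous functionals,
evaluated on a signature, multiply by the shuffle product, and dilation preserves this. After
normalization they are bounded and continuous, and their span is an algebra. It separates paths: the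
time word of length one reveals the scale, and words `ℓ τ ⋯ τ` with time letter `τ` recover each
increment. A point-separating algebra of bounded continuous functions determines finite measures on
a Polish space. Injectivity at rank `r` transports this from paths of tensors to paths in `Prob_r`.
-/

theorem integrable_of_measurable_of_abs_le {α : Type*} [MeasurableSpace α] {μ : Measure α}
    [IsFiniteMeasure μ] {F : α → ℝ} (hF : Measurable F) {C : ℝ} (hC : ∀ x, |F x| ≤ C) :
    Integrable F μ :=
  Integrable.of_bound hF.aestronglyMeasurable C (Eventually.of_forall hC)

theorem condExp_comp_ae_eq_integral_condLaw (hm : m ≤ mΩ) (hY : Measurable Y) {F : E → ℝ}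
    (hF : Measurable F) {C : ℝ} (hC : ∀ x, |F x| ≤ C) :
    P[F ∘ Y | m] =ᵐ[P] fun ω => ∫ y, F y ∂(condLaw P m Y ω : Measure E) := by
  -- The conditioning variable is the identity from `(Ω, mΩ)` to `(Ω, m)`; it generates exactly `m`.
  have hid : @Measurable Ω Ω mΩ m id := measurable_id'' hm
  have h := @condExp_ae_eq_integral_condDistrib Ω Ω E ℝ _ _ _ _ mΩ P _ id Y m _ _ hid
    hY.aemeasurable F hF.stronglyMeasurable
    (integrable_of_measurable_of_abs_le (hF.comp hY) fun x => hC (Y x))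
  rwa [MeasurableSpace.comap_id] at h

theorem condLaw_ae_eq_dirac (hm : m ≤ mΩ) (hY : Measurable[m] Y) :
    ∀ᵐ ω ∂P, (condLaw P m Y ω : Measure E) = Measure.dirac (Y ω) := by
  have hid : @Measurable Ω Ω mΩ m id := measurable_id'' hm
  have h := @condDistrib_comp_self Ω Ω E _ _ _ mΩ P _ m id Y hY
  have h2 := @ae_of_ae_map Ω Ω mΩ m P id (@Measurable.aemeasurable _ _ _ m _ _ hid) _ h
  filter_upwards [h2] with ω hω
  simpa [condLaw, Kernel.deterministic_apply] using hω

end CondLaw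

/-- An injective measurable map between standard Borel spaces is a measurable embedding
(Lusin–Souslin), and `x ↦ δ_x` is such a map; its inverse on the image therefore extends measurably.
-/
theorem exists_measurable_leftInverse_dirac (α : Type*) [MeasurableSpace α] [StandardBorelSpace α]
    [Nonempty α] : ∃ D : ProbabilityMeasure α → α, Measurable D ∧
      ∀ (μ : ProbabilityMeasure α) (x : α), (μ : Measure α) = Measure.dirac x → D μ = x := by
  have := standardBorelSpace_probabilityMeasure α
  let d : α → ProbabilityMeasure α := fun x => ⟨Measure.dirac x, inferInstance⟩
  have hd : Measurable d := Measure.measurable_dirac.subtype_mk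
  have hinj : Function.Injective d := fun x y h =>
    (dirac_eq_dirac_iff.1 (congrArg Subtype.val h) : x = y)
  obtain ⟨D, hD, hDd⟩ := (hd.measurableEmbedding hinj).exists_measurable_extend
    measurable_id fun _ => inferInstance
  refine ⟨D, hD, fun μ x h => ?_⟩
  have : μ = d x := Subtype.ext h
  rw [this]
  exact congrFun hDd x

/-! ### Prediction processes of lower rank -/

/-- A probability measure of rank `r + 1`, viewed as a measure. -/
def RankProb.toMeasure {T : ℕ} {V : Type u} [MeasurableSpace V] {r : ℕ}
    (μ : RankProb T V (r + 1)) : Measure (Fin (T + 1) → RankProb T V r) :=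
  (show ProbabilityMeasure (Fin (T + 1) → RankProb T V r) from μ).1

instance {T : ℕ} {V : Type u} [MeasurableSpace V] {r : ℕ} (μ : RankProb T V (r + 1)) :
    IsProbabilityMeasure μ.toMeasure :=
  (show ProbabilityMeasure (Fin (T + 1) → RankProb T V r) from μ).2

theorem RankProb.toMeasure_injective {T : ℕ} {V : Type u} [MeasurableSpace V] {r : ℕ} :
    Function.Injective (RankProb.toMeasure : RankProb T V (r + 1) → _) := fun _ _ h =>
  Subtype.ext h

theorem RankProb.measurable_toMeasure {T : ℕ} {V : Type u} [MeasurableSpace V] {r : ℕ} :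
    Measurable (RankProb.toMeasure : RankProb T V (r + 1) → _) :=
  measurable_subtype_coe (α := Measure (Fin (T + 1) → RankProb T V r))

theorem RankProb.stronglyMeasurable_integral {E : Type*} [NormedAddCommGroup E] [NormedSpace ℝ E]
    {T : ℕ} {V : Type u} [MeasurableSpace V] {r : ℕ}
    {F : (Fin (T + 1) → RankProb T V r) → E} (hF : StronglyMeasurable F) :
    StronglyMeasurable fun μ : RankProb T V (r + 1) => ∫ x, F x ∂μ.toMeasure :=
  hF.integral_kernel (κ := ⟨RankProb.toMeasure, RankProb.measurable_toMeasure⟩)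

section Prediction

variable {T : ℕ} {V : Type u} [MeasurableSpace V] [StandardBorelSpace V] [Nonempty V]

theorem AdaptedProcess.measurable_prediction_last (X : AdaptedProcess.{u, v} T V) (r : ℕ) :
    Measurable[X.ℱ (Fin.last T)] (X.prediction r) := by
  refine @measurable_pi_lambda _ _ _ (_) _ _ fun t => ?_
  cases r with
  | zero => exact (X.adapted t).mono (X.ℱ.mono (Fin.le_last t)) le_rfl
  | succ r =>
    exact (measurable_condLaw X.P (X.ℱ t) (X.prediction r)).mono (X.ℱ.mono (Fin.le_last t)) le_rfl

/-- At the last time all information on `X̂^r` is available, so the conditional law there is a Dirac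
mass and `G` reads its atom. Nothing in `G` depends on the process, which allows one map for both.
-/
theorem exists_measurable_prediction_of_succ (X : AdaptedProcess.{u, v} T V)
    (Y : AdaptedProcess.{u, w} T V) (r : ℕ) :
    ∃ G : (Fin (T + 1) → RankProb T V (r + 1)) → Fin (T + 1) → RankProb T V r, Measurable G ∧
      (∀ᵐ ω ∂X.P, G (X.prediction (r + 1) ω) = X.prediction r ω) ∧
      ∀ᵐ ω ∂Y.P, G (Y.prediction (r + 1) ω) = Y.prediction r ω := by
  obtain ⟨D, hD, hDd⟩ := exists_measurable_leftInverse_dirac (Fin (T + 1) → RankProb T V r)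
  refine ⟨fun x => D (x (Fin.last T)), hD.comp (measurable_pi_apply (Fin.last T)), ?_, ?_⟩
  · filter_upwards [condLaw_ae_eq_dirac (X.ℱ.le (Fin.last T)) (X.measurable_prediction_last r)]
      with ω hω using hDd _ _ hω
  · filter_upwards [condLaw_ae_eq_dirac (Y.ℱ.le (Fin.last T)) (Y.measurable_prediction_last r)]
      with ω hω using hDd _ _ hω

theorem exists_measurable_prediction_of_le (X : AdaptedProcess.{u, v} T V)
    (Y : AdaptedProcess.{u, w} T V) {k r : ℕ} (h : k ≤ r) :
    ∃ G : (Fin (T + 1) → RankProb T V r) → Fin (T + 1) → RankProb T V k, Measurable G ∧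
      (∀ᵐ ω ∂X.P, G (X.prediction r ω) = X.prediction k ω) ∧
      ∀ᵐ ω ∂Y.P, G (Y.prediction r ω) = Y.prediction k ω := by
  induction r, h using Nat.le_induction with
  | base => exact ⟨id, measurable_id, by simp, by simp⟩
  | succ r _ ih =>
    obtain ⟨G, hG, hX, hY⟩ := ih
    obtain ⟨H, hH, hX', hY'⟩ := exists_measurable_prediction_of_succ X Y r
    refine ⟨G ∘ H, hG.comp hH, ?_, ?_⟩
    · filter_upwards [hX, hX'] with ω h1 h2
      rw [Function.comp_apply, h2, h1]
    · filter_upwards [hY, hY'] with ω h1 h2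
      rw [Function.comp_apply, h2, h1]

theorem predictionLaw_eq_iff {X : AdaptedProcess.{u, v} T V} {Y : AdaptedProcess.{u, w} T V}
    {r : ℕ} : X.predictionLaw r = Y.predictionLaw r ↔
      X.P.map (X.prediction r) = Y.P.map (Y.prediction r) :=
  ⟨fun h => congrArg Subtype.val h, fun h => Subtype.ext h⟩

theorem jointPredictionLaw_eq_iff {X : AdaptedProcess.{u, v} T V} {Y : AdaptedProcess.{u, w} T V}
    {r : ℕ} : X.jointPredictionLaw r = Y.jointPredictionLaw r ↔
      X.predictionLaw r = Y.predictionLaw r := by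
  rw [predictionLaw_eq_iff, AdaptedProcess.jointPredictionLaw, AdaptedProcess.jointPredictionLaw]
  constructor
  · intro h
    have h' := congrArg (Measure.map fun x : (i : Fin (r + 1)) → Fin (T + 1) → RankProb T V i =>
      x (Fin.last r)) h
    rw [Measure.map_map (measurable_pi_apply (Fin.last r))
        (measurable_pi_lambda _ fun i : Fin (r + 1) => X.measurable_prediction i),
      Measure.map_map (measurable_pi_apply (Fin.last r))
        (measurable_pi_lambda _ fun i : Fin (r + 1) => Y.measurable_prediction i)] at h'
    exact h'
  · intro h
    -- Both joint laws become images of the rank `r` laws under one common map.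
    choose G hG hX hY using fun i : Fin (r + 1) =>
      exists_measurable_prediction_of_le X Y (Nat.lt_succ_iff.1 i.2)
    have h' := congrArg (Measure.map fun x i => G i x) h
    rw [Measure.map_map (measurable_pi_lambda _ hG) (X.measurable_prediction r),
      Measure.map_map (measurable_pi_lambda _ hG) (Y.measurable_prediction r)] at h'
    convert h' using 1
    · refine Measure.map_congr ?_
      filter_upwards [ae_all_iff.2 hX] with ω hω
      exact funext fun i => (hω i).symm
    · refine Measure.map_congr ?_
      filter_upwards [ae_all_iff.2 hY] with ω hω
      exact funext fun i => (hω i).symm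

end Prediction

/-! ### Families of functions that determine measures -/

section Determining

variable {α : Type*}

/-- The sets `{F > 0}` for `F` in a family of real functions. -/
def positivitySets (𝒢 : Set (α → ℝ)) : Set (Set α) := {s | ∃ F ∈ 𝒢, s = {x | 0 < F x}}

/-- A family of real functions that is stable under composition with bounded continuous functions
of finitely many variables. -/
def StableUnderBoundedContinuous (𝒢 : Set (α → ℝ)) : Prop :=
  ∀ (n : ℕ) (g : (Fin n → ℝ) →ᵇ ℝ) (F : Fin n → α → ℝ), (∀ i, F i ∈ 𝒢) →
    (fun x => g fun i => F i x) ∈ 𝒢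

/-- Bounded continuous functions built by clamping to `[0, 1]`. -/
def clampBCF {β : Type*} [TopologicalSpace β] (h : C(β, ℝ)) : β →ᵇ ℝ :=
  BoundedContinuousFunction.ofNormedAddCommGroup (fun x => max 0 (min 1 (h x)))
    (by fun_prop) 1 fun x => by
      rw [Real.norm_eq_abs, abs_of_nonneg (le_max_left _ _)]
      exact max_le zero_le_one (min_le_left _ _)

theorem clampBCF_apply {β : Type*} [TopologicalSpace β] (h : C(β, ℝ)) (x : β) :
    clampBCF h x = max 0 (min 1 (h x)) := rfl

theorem clampBCF_pos_iff {β : Type*} [TopologicalSpace β] (h : C(β, ℝ)) (x : β) :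
    0 < clampBCF h x ↔ 0 < h x := by
  simp [clampBCF_apply]

variable {𝒢 : Set (α → ℝ)}

theorem StableUnderBoundedContinuous.comp_one (h𝒢 : StableUnderBoundedContinuous 𝒢) {F : α → ℝ}
    (hF : F ∈ 𝒢) (g : C(ℝ, ℝ)) : (fun x => clampBCF g (F x)) ∈ 𝒢 :=
  h𝒢 1 (clampBCF (g.comp ⟨fun y : Fin 1 → ℝ => y 0, by fun_prop⟩)) (fun _ => F) fun _ => hF

/-- Two functions are both positive exactly where their minimum is, and clamping to `[0, 1]` keeps
the minimum bounded without changing where it is positive. -/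
theorem StableUnderBoundedContinuous.isPiSystem (h𝒢 : StableUnderBoundedContinuous 𝒢) :
    IsPiSystem (positivitySets 𝒢) := by
  rintro _ ⟨F, hF, rfl⟩ _ ⟨G, hG, rfl⟩ -
  refine ⟨_, h𝒢 2 (clampBCF ⟨fun y : Fin 2 → ℝ => min (y 0) (y 1), by fun_prop⟩) ![F, G]
    (by simp [Fin.forall_fin_two, hF, hG]), ?_⟩
  ext x
  simp [clampBCF_pos_iff]

theorem StableUnderBoundedContinuous.measurable_of_mem (h𝒢 : StableUnderBoundedContinuous 𝒢)
    {F : α → ℝ} (hF : F ∈ 𝒢) :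
    Measurable[MeasurableSpace.generateFrom (positivitySets 𝒢)] F := by
  refine measurable_of_Ioi fun a => ?_
  refine MeasurableSpace.measurableSet_generateFrom
    ⟨_, h𝒢.comp_one hF ⟨fun y => y - a, by fun_prop⟩, ?_⟩
  ext x
  simp [clampBCF_pos_iff]

theorem tendsto_clamp_nat_mul (y : ℝ) :
    Tendsto (fun k : ℕ => max 0 (min 1 ((k : ℝ) * y))) atTop
      (𝓝 ((Ioi (0 : ℝ)).indicator 1 y)) := by
  by_cases hy : 0 < y
  · rw [indicator_of_mem (by exact hy)]
    refine tendsto_const_nhds.congr' ?_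
    filter_upwards [eventually_ge_atTop ⌈1 / y⌉₊] with k hk
    have : 1 / y ≤ k := (Nat.le_ceil _).trans (by exact_mod_cast hk)
    rw [div_le_iff₀ hy] at this
    simp [this]
  · rw [indicator_of_notMem (by exact hy)]
    refine tendsto_const_nhds.congr fun k => ?_
    rw [max_eq_left]
    exact (min_le_right _ _).trans (mul_nonpos_of_nonneg_of_nonpos (Nat.cast_nonneg k)
      (not_lt.1 hy))

variable [MeasurableSpace α]

theorem tendsto_integral_clamp {F : α → ℝ} (hF : Measurable F) (μ : Measure α)
    [IsFiniteMeasure μ] :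
    Tendsto (fun k : ℕ => ∫ x, clampBCF ⟨fun y : ℝ => (k : ℝ) * y, by fun_prop⟩ (F x) ∂μ) atTop
      (𝓝 (μ.real {x | 0 < F x})) := by
  have hs : MeasurableSet {x | 0 < F x} := measurableSet_lt measurable_const hF
  have h : μ.real {x | 0 < F x} = ∫ x, (Ioi (0 : ℝ)).indicator 1 (F x) ∂μ := by
    rw [← integral_indicator_one hs]
    rfl
  rw [h]
  refine tendsto_integral_of_dominated_convergence (fun _ => 1) (fun k => ?_)
    (integrable_const 1) (fun k => Eventually.of_forall fun x => ?_)
    (Eventually.of_forall fun x => tendsto_clamp_nat_mul (F x))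
  · exact ((BoundedContinuousFunction.continuous _).measurable.comp hF).aestronglyMeasurable
  · rw [Real.norm_eq_abs, clampBCF_apply, abs_of_nonneg (le_max_left _ _)]
    exact max_le zero_le_one (min_le_left _ _)

/-- The clamps of `k * F` to `[0, 1]` stay in the family and converge to the indicator of `{F > 0}`.
The integrals thus fix the measure on a generating π-system. -/
theorem StableUnderBoundedContinuous.measure_ext (h𝒢 : StableUnderBoundedContinuous 𝒢)
    (hmeas : ∀ F ∈ 𝒢, Measurable F)
    (hgen : ‹MeasurableSpace α› = MeasurableSpace.generateFrom (positivitySets 𝒢))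
    {μ ν : Measure α} [IsProbabilityMeasure μ] [IsProbabilityMeasure ν]
    (h : ∀ F ∈ 𝒢, ∫ x, F x ∂μ = ∫ x, F x ∂ν) : μ = ν := by
  refine ext_of_generate_finite _ hgen h𝒢.isPiSystem ?_ (by simp)
  rintro _ ⟨F, hF, rfl⟩
  have h1 := tendsto_integral_clamp (hmeas F hF) μ
  have h2 := tendsto_integral_clamp (hmeas F hF) ν
  refine (measureReal_eq_measureReal_iff).1 (tendsto_nhds_unique h1 (h2.congr fun k => ?_))
  exact (h _ (h𝒢.comp_one hF _)).symm

/-- The kernel version of the same argument: evaluations on positivity sets are limits of measurable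
integrals, and the λ-system steps extend this to all measurable sets. -/
theorem StableUnderBoundedContinuous.measurable_probabilityMeasure {β : Type*}
    [MeasurableSpace β] (h𝒢 : StableUnderBoundedContinuous 𝒢) (hmeas : ∀ F ∈ 𝒢, Measurable F)
    (hgen : ‹MeasurableSpace α› = MeasurableSpace.generateFrom (positivitySets 𝒢))
    {κ : β → ProbabilityMeasure α}
    (h : ∀ F ∈ 𝒢, Measurable fun b => ∫ x, F x ∂(κ b : Measure α)) : Measurable κ := by
  refine Measurable.subtype_mk (Measure.measurable_of_measurable_coe _ fun s hs => ?_)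
  induction s, hs using MeasurableSpace.induction_on_inter hgen h𝒢.isPiSystem with
  | empty => simp
  | basic s hs =>
    obtain ⟨F, hF, rfl⟩ := hs
    have : Measurable fun b => (κ b : Measure α).real {x | 0 < F x} :=
      measurable_of_tendsto_metrizable (fun k => h _ (h𝒢.comp_one hF _))
        (tendsto_pi_nhds.2 fun b => tendsto_integral_clamp (hmeas F hF) (κ b : Measure α))
    simpa [Measure.real] using this.ennreal_ofReal
  | compl s hs ih =>
    have h1 : Measurable fun b => 1 - (κ b : Measure α) s := measurable_const.sub ih
    have h2 : (fun b => 1 - (κ b : Measure α) s) = fun b => (κ b : Measure α) sᶜ :=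
      funext fun b => (prob_compl_eq_one_sub hs).symm
    exact h2 ▸ h1
  | iUnion f hd hf ih =>
    simp_rw [measure_iUnion hd hf]
    exact Measurable.tsum ih

end Determining

/-! ### Adapted functionals and prediction processes -/

section AdaptedFunctionals

variable {T : ℕ} {V : Type u} [TopologicalSpace V] [MeasurableSpace V] [StandardBorelSpace V]
  [Nonempty V]

/-- The bounded measurable functions of the rank `r` prediction process that represent an adapted
functional of rank at most `r`, simultaneously for both processes. -/
def representingFunctions (X : AdaptedProcess.{u, v} T V) (Y : AdaptedProcess.{u, w} T V) (r : ℕ) :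
    Set ((Fin (T + 1) → RankProb T V r) → ℝ) :=
  {F | Measurable F ∧ (∃ C, ∀ x, |F x| ≤ C) ∧ ∃ f : AdaptedFunctional T V, f.rank ≤ r ∧
    f.eval X =ᵐ[X.P] F ∘ X.prediction r ∧ f.eval Y =ᵐ[Y.P] F ∘ Y.prediction r}

theorem representingFunctions_stable (X : AdaptedProcess.{u, v} T V)
    (Y : AdaptedProcess.{u, w} T V) (r : ℕ) :
    StableUnderBoundedContinuous (representingFunctions X Y r) := by
  intro n g F hF
  choose hm hb f hr hX hY using hF
  refine ⟨g.continuous.measurable.comp (measurable_pi_lambda _ hm),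
    ⟨‖g‖, fun x => g.norm_coe_le_norm _⟩, .comp n g f, Finset.sup_le fun i _ => hr i, ?_, ?_⟩
  · filter_upwards [ae_all_iff.2 hX] with ω hω
    simp [AdaptedFunctional.eval, hω]
  · filter_upwards [ae_all_iff.2 hY] with ω hω
    simp [AdaptedFunctional.eval, hω]

theorem AdaptedFunctional.eval_condExp_ae_eq (X : AdaptedProcess.{u, v} T V) {r : ℕ}
    {f : AdaptedFunctional T V} {F : (Fin (T + 1) → RankProb T V r) → ℝ} (hF : Measurable F)
    {C : ℝ} (hC : ∀ x, |F x| ≤ C) (h : f.eval X =ᵐ[X.P] F ∘ X.prediction r) (t : Fin (T + 1)) :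
    (AdaptedFunctional.condExp t f).eval X =ᵐ[X.P] fun ω =>
      ∫ y, F y ∂(X.prediction (r + 1) ω t).toMeasure :=
  (condExp_congr_ae h).trans
    (condExp_comp_ae_eq_integral_condLaw (X.ℱ.le t) (X.measurable_prediction r) hF hC)

theorem integral_mem_representingFunctions {X : AdaptedProcess.{u, v} T V}
    {Y : AdaptedProcess.{u, w} T V} {r : ℕ} {F : (Fin (T + 1) → RankProb T V r) → ℝ}
    (hF : F ∈ representingFunctions X Y r) (t : Fin (T + 1)) :
    (fun x : Fin (T + 1) → RankProb T V (r + 1) =>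
      ∫ y, F y ∂(x t).toMeasure) ∈ representingFunctions X Y (r + 1) := by
  obtain ⟨hm, ⟨C, hC⟩, f, hr, hX, hY⟩ := hF
  refine ⟨(RankProb.stronglyMeasurable_integral hm.stronglyMeasurable).measurable.comp
    (measurable_pi_apply t), ⟨C, fun x => ?_⟩,
    .condExp t f, Nat.succ_le_succ hr, AdaptedFunctional.eval_condExp_ae_eq X hm hC hX t,
    AdaptedFunctional.eval_condExp_ae_eq Y hm hC hY t⟩
  simpa using norm_integral_le_of_norm_le_const (C := C) (μ := (x t).toMeasure) (f := F)
    (Eventually.of_forall hC)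

theorem generateFrom_positivitySets_representingFunctions_le (X : AdaptedProcess.{u, v} T V)
    (Y : AdaptedProcess.{u, w} T V) (r : ℕ) :
    MeasurableSpace.generateFrom (positivitySets (representingFunctions X Y r)) ≤
      (inferInstance : MeasurableSpace (Fin (T + 1) → RankProb T V r)) := by
  refine MeasurableSpace.generateFrom_le ?_
  rintro _ ⟨F, hF, rfl⟩
  exact measurableSet_lt measurable_const hF.1

variable [PolishSpace V] [BorelSpace V]

/-- Induction on the construction of the functional, for all `r` at once: a conditional expectation
uses up one rank, and marginals pass from rank `0` to rank `r` by atom reading. -/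
theorem exists_representation (X : AdaptedProcess.{u, v} T V) (Y : AdaptedProcess.{u, w} T V)
    (f : AdaptedFunctional T V) {r : ℕ} (hr : f.rank ≤ r) :
    ∃ F : (Fin (T + 1) → RankProb T V r) → ℝ, Measurable F ∧ (∃ C, ∀ x, |F x| ≤ C) ∧
      f.eval X =ᵐ[X.P] F ∘ X.prediction r ∧ f.eval Y =ᵐ[Y.P] F ∘ Y.prediction r := by
  induction f generalizing r with
  | marginal n t g =>
    obtain ⟨G, hG, hX, hY⟩ := exists_measurable_prediction_of_le X Y (Nat.zero_le r)
    have hm : Measurable fun x => (g fun i => (show V from G x (t i))) := by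
      refine g.continuous.measurable.comp (measurable_pi_lambda _ fun i => ?_)
      exact (measurable_pi_apply (t i)).comp hG
    refine ⟨_, hm, ⟨‖g‖, fun x => g.norm_coe_le_norm _⟩, ?_, ?_⟩
    · filter_upwards [hX] with ω hω
      simp only [AdaptedFunctional.eval, Function.comp_apply, hω]
      rfl
    · filter_upwards [hY] with ω hω
      simp only [AdaptedFunctional.eval, Function.comp_apply, hω]
      rfl
  | comp n g f ih =>
    choose F hm hb hX hY using fun i => ih i ((Finset.le_sup (f := fun i => (f i).rank)
      (Finset.mem_univ i)).trans hr)
    refine ⟨fun x => g fun i => F i x, g.continuous.measurable.comp (measurable_pi_lambda _ hm),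
      ⟨‖g‖, fun x => g.norm_coe_le_norm _⟩, ?_, ?_⟩
    · filter_upwards [ae_all_iff.2 hX] with ω hω
      simp [AdaptedFunctional.eval, hω]
    · filter_upwards [ae_all_iff.2 hY] with ω hω
      simp [AdaptedFunctional.eval, hω]
  | condExp t f ih =>
    obtain _ | r := r
    · simp [AdaptedFunctional.rank] at hr
    · have hr' : f.rank ≤ r := Nat.le_of_succ_le_succ hr
      obtain ⟨F, hm, hb, hX, hY⟩ := ih hr'
      obtain ⟨hm', hb', -⟩ := integral_mem_representingFunctions
        (X := X) (Y := Y) ⟨hm, hb, f, hr', hX, hY⟩ t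
      obtain ⟨C, hC⟩ := hb
      exact ⟨_, hm', hb', AdaptedFunctional.eval_condExp_ae_eq X hm hC hX t,
        AdaptedFunctional.eval_condExp_ae_eq Y hm hC hY t⟩

/-- In a metric for `V`, an open set is the positivity set of the distance to its complement. -/
theorem measurable_eval_zero (X : AdaptedProcess.{u, v} T V) (Y : AdaptedProcess.{u, w} T V)
    (t : Fin (T + 1)) :
    @Measurable (Fin (T + 1) → V) V
      (MeasurableSpace.generateFrom (positivitySets (representingFunctions X Y 0))) _
      (fun x => x t) := by
  let := TopologicalSpace.upgradeIsCompletelyMetrizable V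
  refine @measurable_of_isOpen _ _ _ _ _ (_) _ fun U hU => ?_
  -- The distance to the empty set is `0` by convention, so `U = univ` needs its own argument.
  by_cases hne : (Uᶜ).Nonempty
  · let g : V →ᵇ ℝ := clampBCF ⟨fun v => Metric.infDist v Uᶜ, Metric.continuous_infDist_pt _⟩
    let g' : (Fin 1 → V) →ᵇ ℝ := g.compContinuous ⟨fun y => y 0, by fun_prop⟩
    refine MeasurableSpace.measurableSet_generateFrom
      ⟨fun x => g (x t), ⟨?_, ⟨‖g‖, fun x => g.norm_coe_le_norm _⟩,
        .marginal 1 (fun _ => t) g', le_rfl, Eventually.of_forall fun ω => rfl,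
        Eventually.of_forall fun ω => rfl⟩, ?_⟩
    · exact g.continuous.measurable.comp (measurable_pi_apply (X := fun _ => V) t)
    · ext x
      change _ ↔ 0 < g (x t)
      rw [clampBCF_pos_iff, ContinuousMap.coe_mk,
        ← hU.isClosed_compl.notMem_iff_infDist_pos hne, notMem_compl_iff, mem_preimage]
  · rw [not_nonempty_iff_eq_empty, compl_empty_iff] at hne
    subst hne
    exact MeasurableSet.univ

/-- This is where adapted functionals are seen to be rich enough. The σ-algebra on `Prob_{r+1}` is
tested by integrals of rank `r` representing functions, and such an integral against the time `t`
coordinate represents a conditional expectation of rank at most `r + 1`. -/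
theorem measurableSpace_eq_generateFrom_representingFunctions (X : AdaptedProcess.{u, v} T V)
    (Y : AdaptedProcess.{u, w} T V) (r : ℕ) :
    (inferInstance : MeasurableSpace (Fin (T + 1) → RankProb T V r)) =
      MeasurableSpace.generateFrom (positivitySets (representingFunctions X Y r)) := by
  refine le_antisymm ?_ (generateFrom_positivitySets_representingFunctions_le X Y r)
  induction r with
  | zero =>
    refine iSup_le fun t => measurable_iff_comap_le.1 (measurable_eval_zero X Y t)
  | succ r ih =>
    have hgen := le_antisymm ih (generateFrom_positivitySets_representingFunctions_le X Y r)
    refine iSup_le fun t => measurable_iff_comap_le.1 ?_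
    -- The domain carries the generated σ-algebra here, not the product one, hence the explicit
    -- instance arguments.
    exact @StableUnderBoundedContinuous.measurable_probabilityMeasure _ _ _ _
      (MeasurableSpace.generateFrom (positivitySets (representingFunctions X Y (r + 1))))
      (representingFunctions_stable X Y r) (fun F hF => hF.1) hgen
      (fun x : Fin (T + 1) → RankProb T V (r + 1) => x t)
      fun F hF => (representingFunctions_stable X Y (r + 1)).measurable_of_mem
        (integral_mem_representingFunctions hF t)

theorem forall_integral_eval_eq_iff_predictionLaw_eq (X : AdaptedProcess.{u, v} T V)
    (Y : AdaptedProcess.{u, w} T V) (r : ℕ) :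
    (∀ f : AdaptedFunctional T V, f.rank ≤ r →
      ∫ ω, f.eval X ω ∂X.P = ∫ ω, f.eval Y ω ∂Y.P) ↔ X.predictionLaw r = Y.predictionLaw r := by
  have hmX := X.measurable_prediction r
  have hmY := Y.measurable_prediction r
  rw [predictionLaw_eq_iff]
  constructor
  · intro h
    have := Measure.isProbabilityMeasure_map (μ := X.P) hmX.aemeasurable
    have := Measure.isProbabilityMeasure_map (μ := Y.P) hmY.aemeasurable
    refine (representingFunctions_stable X Y r).measure_ext (fun F hF => hF.1)
      (measurableSpace_eq_generateFrom_representingFunctions X Y r) ?_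
    rintro F ⟨hF, -, f, hr, hX, hY⟩
    rw [integral_map hmX.aemeasurable hF.aestronglyMeasurable,
      integral_map hmY.aemeasurable hF.aestronglyMeasurable]
    exact (integral_congr_ae hX).symm.trans ((h f hr).trans (integral_congr_ae hY))
  · intro h f hr
    obtain ⟨F, hF, -, hX, hY⟩ := exists_representation X Y f hr
    have h' := congrArg (fun μ => ∫ x, F x ∂μ) h
    simp only [integral_map hmX.aemeasurable hF.aestronglyMeasurable,
      integral_map hmY.aemeasurable hF.aestronglyMeasurable] at h'
    exact (integral_congr_ae hX).trans (h'.trans (integral_congr_ae hY).symm)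

end AdaptedFunctionals

/-! ### Words: deconcatenation and shuffles -/

section Words

variable {D M : Type*}

/-- The sum of `F p q` over all ways to write a word as a concatenation `p ++ q`. -/
def splitSum [AddCommMonoid M] : (List D → List D → M) → List D → M
  | F, [] => F [] []
  | F, a :: w => F [] (a :: w) + splitSum (fun p q => F (a :: p) q) w

/-- The sum of `F w` over all shuffles `w` of two words. -/
def shuffleSum [AddCommMonoid M] : (List D → M) → List D → List D → M
  | F, [], v => F v
  | F, a :: u, [] => F (a :: u)
  | F, a :: u, b :: v =>
    shuffleSum (fun w => F (a :: w)) u (b :: v) + shuffleSum (fun w => F (b :: w)) (a :: u) v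
termination_by _ u v => u.length + v.length

section AddCommMonoid

variable [AddCommMonoid M]

theorem shuffleSum_nil_right (F : List D → M) (u : List D) : shuffleSum F u [] = F u := by
  cases u <;> simp [shuffleSum]

theorem splitSum_add (F G : List D → List D → M) (w : List D) :
    splitSum (fun p q => F p q + G p q) w = splitSum F w + splitSum G w := by
  induction w generalizing F G with
  | nil => simp [splitSum]
  | cons a w ih => simp only [splitSum, ih]; abel

theorem shuffleSum_add (F G : List D → M) (u v : List D) :
    shuffleSum (fun w => F w + G w) u v = shuffleSum F u v + shuffleSum G u v := by
  match u, v with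
  | [], v => simp [shuffleSum]
  | a :: u, [] => simp [shuffleSum]
  | a :: u, b :: v =>
    simp only [shuffleSum]
    rw [shuffleSum_add _ _ u (b :: v), shuffleSum_add _ _ (a :: u) v]
    abel
termination_by u.length + v.length

theorem map_shuffleSum {M' : Type*} [AddCommMonoid M'] (e : M →+ M') (F : List D → M)
    (u v : List D) : e (shuffleSum F u v) = shuffleSum (fun w => e (F w)) u v := by
  match u, v with
  | [], v => simp [shuffleSum]
  | a :: u, [] => simp [shuffleSum]
  | a :: u, b :: v =>
    simp only [shuffleSum, map_add]
    rw [map_shuffleSum e _ u (b :: v), map_shuffleSum e _ (a :: u) v]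
termination_by u.length + v.length

theorem map_splitSum {M' : Type*} [AddCommMonoid M'] (e : M →+ M') (F : List D → List D → M)
    (w : List D) : e (splitSum F w) = splitSum (fun p q => e (F p q)) w := by
  induction w generalizing F with
  | nil => simp [splitSum]
  | cons a w ih => simp only [splitSum, map_add, ih]

theorem shuffleSum_mem {S : Type*} [SetLike S M] [AddMemClass S M] (s : S)
    {F : List D → M} (hF : ∀ w, F w ∈ s) (u v : List D) : shuffleSum F u v ∈ s := by
  match u, v with
  | [], v => simpa [shuffleSum] using hF v
  | a :: u, [] => simpa [shuffleSum] using hF (a :: u)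
  | a :: u, b :: v =>
    simp only [shuffleSum]
    exact add_mem (shuffleSum_mem s (fun w => hF _) u (b :: v))
      (shuffleSum_mem s (fun w => hF _) (a :: u) v)
termination_by u.length + v.length

/-- A sum over shuffles only involves words of the total length. -/
theorem shuffleSum_congr_length {F G : List D → M} {u v : List D}
    (h : ∀ w : List D, w.length = u.length + v.length → F w = G w) :
    shuffleSum F u v = shuffleSum G u v := by
  match u, v with
  | [], v => simpa [shuffleSum] using h v (by simp)
  | a :: u, [] => simpa [shuffleSum] using h (a :: u) (by simp)
  | a :: u, b :: v =>
    simp only [shuffleSum]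
    rw [shuffleSum_congr_length (u := u) (v := b :: v) fun w hw => h (a :: w) (by simp [hw]; omega),
      shuffleSum_congr_length (u := a :: u) (v := v) fun w hw => h (b :: w) (by simp [hw]; omega)]
termination_by u.length + v.length

theorem splitSum_eq_sum_range (F : List D → List D → M) (w : List D) :
    splitSum F w = ∑ i ∈ Finset.range (w.length + 1), F (w.take i) (w.drop i) := by
  induction w generalizing F with
  | nil => simp [splitSum]
  | cons a w ih =>
    rw [splitSum, ih, List.length_cons, Finset.sum_range_succ' _ (w.length + 1), add_comm]
    simp

/-- Deconcatenation is a morphism for the shuffle product. -/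
theorem shuffleSum_splitSum (F : List D → List D → M) (u v : List D) :
    shuffleSum (fun w => splitSum F w) u v =
      splitSum (fun u₁ u₂ => splitSum (fun v₁ v₂ =>
        shuffleSum (fun w₁ => shuffleSum (fun w₂ => F w₁ w₂) u₂ v₂) u₁ v₁) v) u := by
  match u, v with
  | [], v => simp [shuffleSum, splitSum]
  | a :: u, [] => simp [shuffleSum_nil_right, splitSum]
  | a :: u, b :: v =>
    rw [shuffleSum]
    -- Cuts before the first letter give the terms in which both left parts are empty. The remaining
    -- terms start with `a` or `b` on the left and are covered by the recursion on total length.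
    simp only [splitSum, shuffleSum_add]
    rw [shuffleSum_splitSum _ u (b :: v), shuffleSum_splitSum _ (a :: u) v]
    simp only [splitSum, shuffleSum, splitSum_add, shuffleSum_nil_right]
    abel
termination_by u.length + v.length

end AddCommMonoid

/-- Characters of the shuffle algebra. -/
structure IsShuffleCharacter (φ : List D → ℝ) : Prop where
  nil : φ [] = 1
  mul : ∀ u v, φ u * φ v = shuffleSum φ u v

/-- The convolution product of functionals on words. -/
def wordConv (φ ψ : List D → ℝ) (w : List D) : ℝ := splitSum (fun p q => φ p * ψ q) w

/-- The counit of the shuffle algebra. -/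
def wordOne : List D → ℝ
  | [] => 1
  | _ :: _ => 0

/-- The exponential of a functional on letters. -/
def wordExp (c : D → ℝ) (w : List D) : ℝ := (w.length.factorial : ℝ)⁻¹ * (w.map c).prod

theorem isShuffleCharacter_wordOne : IsShuffleCharacter (wordOne : List D → ℝ) where
  nil := rfl
  mul u v := by
    have h0 : ∀ u v : List D, shuffleSum (fun _ => (0 : ℝ)) u v = 0 := fun u v => by
      simpa using (map_shuffleSum (0 : ℝ →+ ℝ) (fun _ => (0 : ℝ)) u v).symm
    match u, v with
    | [], v => simp [shuffleSum, wordOne]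
    | a :: u, [] => simp [shuffleSum, wordOne]
    | a :: u, b :: v => simp [shuffleSum, wordOne, h0]

theorem splitSum_mul_left (c : ℝ) (F : List D → List D → ℝ) (w : List D) :
    c * splitSum F w = splitSum (fun p q => c * F p q) w :=
  map_splitSum (AddMonoidHom.mulLeft c) F w

theorem shuffleSum_mul_left (c : ℝ) (F : List D → ℝ) (u v : List D) :
    c * shuffleSum F u v = shuffleSum (fun w => c * F w) u v :=
  map_shuffleSum (AddMonoidHom.mulLeft c) F u v

theorem splitSum_mul_right (c : ℝ) (F : List D → List D → ℝ) (w : List D) :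
    splitSum F w * c = splitSum (fun p q => F p q * c) w :=
  map_splitSum (AddMonoidHom.mulRight c) F w

theorem shuffleSum_mul_right (c : ℝ) (F : List D → ℝ) (u v : List D) :
    shuffleSum F u v * c = shuffleSum (fun w => F w * c) u v :=
  map_shuffleSum (AddMonoidHom.mulRight c) F u v

/-- Dual to the compatibility of deconcatenation with shuffles (`shuffleSum_splitSum`). -/
theorem IsShuffleCharacter.conv {φ ψ : List D → ℝ} (hφ : IsShuffleCharacter φ)
    (hψ : IsShuffleCharacter ψ) : IsShuffleCharacter (wordConv φ ψ) where
  nil := by simp [wordConv, splitSum, hφ.nil, hψ.nil]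
  mul u v := by
    have h : shuffleSum (wordConv φ ψ) u v = _ := shuffleSum_splitSum (fun p q => φ p * ψ q) u v
    rw [h, wordConv, wordConv, splitSum_mul_right]
    congr! 3 with u₁ u₂
    rw [splitSum_mul_left]
    congr! 3 with v₁ v₂
    simp_rw [← shuffleSum_mul_left, ← hψ.mul, ← shuffleSum_mul_right, ← hφ.mul]
    ring

/-- All shuffles of `u` and `v` have the same length and the same letters, so the sum only counts
them. A general weight `g` is needed because prefixing a letter shifts it; the count then follows
Pascal's rule. -/
theorem shuffleSum_length_mul_prod (c : D → ℝ) (g : ℕ → ℝ) (u v : List D) :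
    shuffleSum (fun w => g w.length * (w.map c).prod) u v =
      ((u.length + v.length).choose u.length : ℝ) * g (u.length + v.length) *
        ((u.map c).prod * (v.map c).prod) := by
  match u, v with
  | [], v => simp [shuffleSum]
  | a :: u, [] => simp [shuffleSum]
  | a :: u, b :: v =>
    have h : ∀ d : D, (fun w : List D => g (d :: w).length * ((d :: w).map c).prod) =
        fun w => (fun n => c d * g (n + 1)) w.length * (w.map c).prod := fun d => by
      funext w
      simp only [List.length_cons, List.map_cons, List.prod_cons]
      ring
    rw [shuffleSum, h a, h b, shuffleSum_length_mul_prod c (fun n => c a * g (n + 1)) u (b :: v),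
      shuffleSum_length_mul_prod c (fun n => c b * g (n + 1)) (a :: u) v]
    simp only [List.length_cons, List.map_cons, List.prod_cons]
    rw [show u.length + 1 + (v.length + 1) = u.length + v.length + 1 + 1 by ring,
      show u.length + (v.length + 1) = u.length + v.length + 1 by ring,
      show u.length + 1 + v.length = u.length + v.length + 1 by ring,
      Nat.choose_succ_succ (u.length + v.length + 1) u.length]
    push_cast
    ring
termination_by u.length + v.length

theorem isShuffleCharacter_wordExp (c : D → ℝ) : IsShuffleCharacter (wordExp c) where
  nil := by simp [wordExp]
  mul u v := by
    have h := shuffleSum_length_mul_prod c (fun n => (n.factorial : ℝ)⁻¹) u v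
    simp only [wordExp] at h ⊢
    refine Eq.trans ?_ h.symm
    have hc : ((u.length + v.length).choose u.length : ℝ) * ((u.length + v.length).factorial : ℝ)⁻¹
        = (u.length.factorial : ℝ)⁻¹ * (v.length.factorial : ℝ)⁻¹ := by
      have h1 := Nat.choose_mul_factorial_mul_factorial (Nat.le_add_right u.length v.length)
      rw [Nat.add_sub_cancel_left] at h1
      have h2 : ((u.length + v.length).choose u.length : ℝ) * u.length.factorial *
        v.length.factorial = (u.length + v.length).factorial := by exact_mod_cast h1
      rw [← h2]
      have := Nat.factorial_ne_zero u.length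
      have := Nat.factorial_ne_zero v.length
      have : (u.length + v.length).choose u.length ≠ 0 :=
        (Nat.choose_pos (Nat.le_add_right _ _)).ne'
      field_simp
    rw [hc]
    ring

theorem IsShuffleCharacter.dilate {φ : List D → ℝ} (hφ : IsShuffleCharacter φ) (c : ℝ) :
    IsShuffleCharacter fun w => c ^ w.length * φ w where
  nil := by simp [hφ.nil]
  mul u v := by
    rw [shuffleSum_congr_length (G := fun w => c ^ (u.length + v.length) * φ w)
      (fun w hw => by rw [hw]), ← shuffleSum_mul_left, ← hφ.mul]
    ring

/-- The product of the exponentials of a list of functionals on letters. -/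
def wordSig (l : List (D → ℝ)) : List D → ℝ := (l.map wordExp).foldr wordConv wordOne

theorem isShuffleCharacter_wordSig (l : List (D → ℝ)) : IsShuffleCharacter (wordSig l) := by
  induction l with
  | nil => exact isShuffleCharacter_wordOne
  | cons c l ih => exact (isShuffleCharacter_wordExp c).conv ih

theorem wordSig_cons (c : D → ℝ) (l : List (D → ℝ)) (w : List D) :
    wordSig (c :: l) w = splitSum (fun p q => wordExp c p * wordSig l q) w := rfl

/-! ### Recovering letters from words padded with the time letter -/

theorem splitSum_replicate (F : List D → List D → ℝ) (a : D) (j : ℕ) :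
    splitSum F (List.replicate j a) =
      ∑ i ∈ Finset.range (j + 1), F (List.replicate i a) (List.replicate (j - i) a) := by
  rw [splitSum_eq_sum_range, List.length_replicate]
  refine Finset.sum_congr rfl fun i hi => ?_
  rw [List.take_replicate, List.drop_replicate,
    min_eq_left (Nat.lt_succ_iff.1 (Finset.mem_range.1 hi))]

/-- On powers of `τ` every factor looks like `exp(1)`, so a product of `n` factors looks like
`exp(n)`; this is the binomial theorem. -/
theorem wordSig_replicate {τ : D} {l : List (D → ℝ)} (hl : ∀ c ∈ l, c τ = 1) (j : ℕ) :
    (j.factorial : ℝ) * wordSig l (List.replicate j τ) = (l.length : ℝ) ^ j := by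
  induction l generalizing j with
  | nil =>
    cases j with
    | zero => simp [wordSig, wordOne]
    | succ j => simp [wordSig, wordOne, List.replicate_succ]
  | cons c l ih =>
    rw [wordSig_cons, splitSum_replicate, List.length_cons, Nat.cast_add, Nat.cast_one,
      add_comm (l.length : ℝ), add_pow, Finset.mul_sum]
    refine Finset.sum_congr rfl fun i hi => ?_
    have hi' : i ≤ j := Nat.lt_succ_iff.1 (Finset.mem_range.1 hi)
    rw [← ih (fun c hc => hl c (List.mem_cons_of_mem _ hc)), wordExp, List.length_replicate,
      List.map_replicate, hl c List.mem_cons_self, List.prod_replicate, one_pow,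
      ← Nat.choose_mul_factorial_mul_factorial hi']
    push_cast
    field_simp

/-- The sum `∑ₜ dₜ (f(kₜ + 1) - f(kₜ))` where `kₜ` is the number of entries after the `t`-th. -/
def incrementSum : List ℝ → (ℕ → ℝ) → ℝ
  | [], _ => 0
  | d :: l, f => d * (f (l.length + 1) - f l.length) + incrementSum l f

/-- The factor that absorbs `ℓ` is the first to receive a nonempty part of the word; only it and the
factors after it share the letters `τ`. This weights each value at `ℓ` by a difference of powers
that depends on the position, which makes the positions distinguishable. -/
theorem wordSig_cons_replicate {τ ℓ : D} {l : List (D → ℝ)} (hl : ∀ c ∈ l, c τ = 1) (j : ℕ) :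
    ((j + 1).factorial : ℝ) * wordSig l (ℓ :: List.replicate j τ) =
      incrementSum (l.map fun c => c ℓ) fun k => (k : ℝ) ^ (j + 1) := by
  induction l with
  | nil => simp [wordSig, wordOne, incrementSum]
  | cons c l ih =>
    have hl' : ∀ c ∈ l, c τ = 1 := fun c hc => hl c (List.mem_cons_of_mem _ hc)
    rw [wordSig_cons, splitSum, mul_add, List.map_cons, incrementSum, ← ih hl', add_comm]
    congr 1
    -- The difference of powers is the binomial expansion of `(1 + n) ^ (j + 1)` without its term `i
    -- = 0`, where `n = l.length`.
    · rw [splitSum_replicate, List.length_map, Nat.cast_add, Nat.cast_one, add_comm (l.length : ℝ),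
        add_pow, Finset.sum_range_succ' _ (j + 1), Finset.mul_sum]
      simp only [one_pow, one_mul, Nat.sub_zero, Nat.choose_zero_right, Nat.cast_one, mul_one,
        add_sub_cancel_right, Nat.add_sub_add_right]
      rw [Finset.mul_sum]
      refine Finset.sum_congr rfl fun i hi => ?_
      have hi' : i ≤ j := Nat.lt_succ_iff.1 (Finset.mem_range.1 hi)
      rw [← wordSig_replicate hl', wordExp, List.length_cons, List.length_replicate,
        List.map_cons, List.map_replicate, hl c List.mem_cons_self, List.prod_cons,
        List.prod_replicate, one_pow,
        ← Nat.choose_mul_factorial_mul_factorial (Nat.succ_le_succ hi'), Nat.succ_sub_succ]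
      push_cast
      field_simp
    · simp [wordExp]

theorem incrementSum_add (l : List ℝ) (f g : ℕ → ℝ) :
    incrementSum l (fun k => f k + g k) = incrementSum l f + incrementSum l g := by
  induction l with
  | nil => simp [incrementSum]
  | cons d l ih => simp only [incrementSum, ih]; ring

theorem incrementSum_const_mul (l : List ℝ) (a : ℝ) (f : ℕ → ℝ) :
    incrementSum l (fun k => a * f k) = a * incrementSum l f := by
  induction l with
  | nil => simp [incrementSum]
  | cons d l ih => simp only [incrementSum, ih]; ring

theorem incrementSum_const (l : List ℝ) (a : ℝ) : incrementSum l (fun _ => a) = 0 := by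
  induction l with
  | nil => rfl
  | cons d l ih => simp [incrementSum, ih]

theorem incrementSum_eq_zero (l : List ℝ) {f : ℕ → ℝ} (hf : ∀ k ≤ l.length, f k = 0) :
    incrementSum l f = 0 := by
  induction l with
  | nil => rfl
  | cons d l ih =>
    rw [incrementSum, ih fun k hk => hf k (hk.trans (Nat.le_succ _)), hf _ (Nat.le_succ _),
      hf (l.length + 1) le_rfl]
    simp

/-- A polynomial that vanishes at `0, …, l.length` but not at `l.length + 1` isolates the first
entry. Cancelling that entry leaves the same statement for the tails. -/
theorem eq_of_forall_incrementSum_eq {l l' : List ℝ} (hlen : l.length = l'.length)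
    (h : ∀ p : Polynomial ℝ, incrementSum l (fun k => p.eval (k : ℝ)) =
      incrementSum l' fun k => p.eval (k : ℝ)) : l = l' := by
  induction l generalizing l' with
  | nil => exact (List.length_eq_zero_iff.1 hlen.symm).symm
  | cons d l ih =>
    obtain _ | ⟨d', l'⟩ := l'
    · simp at hlen
    have hlen' : l.length = l'.length := by simpa using hlen
    have hd : d = d' := by
      let p : Polynomial ℝ :=
        ∏ i ∈ Finset.range (l.length + 1), (Polynomial.X - Polynomial.C (i : ℝ))
      have hp : ∀ k : ℕ, p.eval (k : ℝ) = ∏ i ∈ Finset.range (l.length + 1), ((k : ℝ) - i) :=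
        fun k => by simp [p, Polynomial.eval_prod]
      have hp0 : ∀ k ≤ l.length, p.eval (k : ℝ) = 0 := fun k hk => by
        rw [hp]
        exact Finset.prod_eq_zero (Finset.mem_range.2 (Nat.lt_succ_iff.2 hk)) (sub_self _)
      have hp1 : p.eval ((l.length + 1 : ℕ) : ℝ) ≠ 0 := by
        rw [hp, Finset.prod_ne_zero_iff]
        intro i hi
        rw [sub_ne_zero]
        exact_mod_cast (Finset.mem_range.1 hi).ne'
      have h1 := h p
      simp only [incrementSum] at h1
      rw [incrementSum_eq_zero l hp0, incrementSum_eq_zero l' (hlen' ▸ hp0), ← hlen',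
        hp0 _ le_rfl, add_zero, add_zero, sub_zero] at h1
      exact mul_right_cancel₀ hp1 h1
    subst hd
    rw [ih hlen' fun p => ?_]
    have h1 := h p
    simp only [incrementSum, hlen'] at h1
    exact add_left_cancel h1

/-- The values on words determine the values on letters, if one letter takes the value `1`. -/
theorem map_apply_eq_of_wordSig_eq {τ : D} {l l' : List (D → ℝ)} (hlen : l.length = l'.length)
    (hl : ∀ c ∈ l, c τ = 1) (hl' : ∀ c ∈ l', c τ = 1) (h : wordSig l = wordSig l') (ℓ : D) :
    (l.map fun c => c ℓ) = l'.map fun c => c ℓ := by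
  refine eq_of_forall_incrementSum_eq (by simpa using hlen) fun p => ?_
  induction p using Polynomial.induction_on' with
  | add p q hp hq => simp only [Polynomial.eval_add, incrementSum_add, hp, hq]
  | monomial n a =>
    simp only [Polynomial.eval_monomial, incrementSum_const_mul]
    congr 1
    cases n with
    | zero => simp [incrementSum_const]
    | succ j => rw [← wordSig_cons_replicate hl, ← wordSig_cons_replicate hl', h]

end Words

/-! ### Words of continuous functionals acting on tensor sequences -/

section Pairing

variable {F : Type u} [NormedAddCommGroup F] [NormedSpace ℝ F]

/-- The functional `ℓ₁ ⊗ ⋯ ⊗ ℓₘ` on the `m`-th tensor power. -/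
def tensorFunctional {m : ℕ} (ℓ : Fin m → StrongDual ℝ F) : (⨂[ℝ]^m F) →ₗ[ℝ] ℝ :=
  PiTensorProduct.lift ((MultilinearMap.mkPiAlgebra ℝ (Fin m) ℝ).compLinearMap
    fun i => (ℓ i).toLinearMap)

theorem tensorFunctional_tprod {m : ℕ} (ℓ : Fin m → StrongDual ℝ F) (v : Fin m → F) :
    tensorFunctional ℓ (PiTensorProduct.tprod ℝ v) = ∏ i, ℓ i (v i) := by
  simp [tensorFunctional]

theorem tensorFunctional_mul {i j : ℕ} (ℓ : Fin (i + j) → StrongDual ℝ F) (a : ⨂[ℝ]^i F)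
    (b : ⨂[ℝ]^j F) :
    tensorFunctional ℓ (GradedMonoid.GMul.mul (A := fun i => ⨂[ℝ]^i F) a b) =
      tensorFunctional (fun k => ℓ (Fin.castAdd j k)) a *
        tensorFunctional (fun k => ℓ (Fin.natAdd i k)) b := by
  rw [TensorPower.gMul_eq_coe_linearMap]
  induction a using PiTensorProduct.induction_on with
  | add a a' ha ha' => simp only [map_add, LinearMap.add_apply, ha, ha', add_mul]
  | smul_tprod c v =>
    induction b using PiTensorProduct.induction_on with
    | add b b' hb hb' => simp only [map_add, hb, hb', mul_add]
    | smul_tprod d v' =>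
      simp only [map_smul, LinearMap.smul_apply]
      rw [← TensorPower.gMul_eq_coe_linearMap, TensorPower.tprod_mul_tprod,
        tensorFunctional_tprod, tensorFunctional_tprod, tensorFunctional_tprod,
        Fin.prod_univ_add]
      simp only [Fin.append_left, Fin.append_right, smul_eq_mul]
      ring

/-- The functional on the `m`-th tensor power given by the first `m` letters of a word. -/
def wordFunctional (w : List (StrongDual ℝ F)) (m : ℕ) : (⨂[ℝ]^m F) →ₗ[ℝ] ℝ :=
  -- The default `0` enters only for `m > w.length`; it makes the functional total in `m`, so that
  -- no casts along lengths are needed.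
  tensorFunctional fun k : Fin m => w.getD k 0

/-- The pairing of words with tensor sequences. -/
def wordPairing (s : (m : ℕ) → ⨂[ℝ]^m F) (w : List (StrongDual ℝ F)) : ℝ :=
  wordFunctional w w.length (s w.length)

theorem wordFunctional_mul (w : List (StrongDual ℝ F)) {i j m : ℕ} (h : i + j = m) (a : ⨂[ℝ]^i F)
    (b : ⨂[ℝ]^j F) :
    wordFunctional w m (TensorPower.cast ℝ F h
      (GradedMonoid.GMul.mul (A := fun i => ⨂[ℝ]^i F) a b)) =
      wordFunctional w i a * wordFunctional (w.drop i) j b := by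
  subst h
  rw [TensorPower.cast_refl, LinearEquiv.refl_apply, wordFunctional, tensorFunctional_mul]
  simp [wordFunctional, List.getD_eq_getElem?_getD, List.getElem?_drop]

theorem wordFunctional_take (w : List (StrongDual ℝ F)) (i : ℕ) :
    wordFunctional (w.take i) i = wordFunctional w i := by
  simp [wordFunctional, List.getD_eq_getElem?_getD]

theorem wordPairing_conv (s t : (m : ℕ) → ⨂[ℝ]^m F) :
    wordPairing (tensorConv s t) = wordConv (wordPairing s) (wordPairing t) := by
  funext w
  rw [wordPairing, tensorConv, map_sum]
  simp only [wordFunctional_mul]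
  rw [Finset.sum_attach _ fun p : ℕ × ℕ =>
      wordFunctional w p.1 (s p.1) * wordFunctional (w.drop p.1) p.2 (t p.2),
    Finset.Nat.sum_antidiagonal_eq_sum_range_succ fun i j =>
      wordFunctional w i (s i) * wordFunctional (w.drop i) j (t j),
    wordConv, splitSum_eq_sum_range]
  refine Finset.sum_congr rfl fun i hi => ?_
  have hi' : i ≤ w.length := Nat.lt_succ_iff.1 (Finset.mem_range.1 hi)
  rw [wordPairing, wordPairing, List.length_take, List.length_drop, min_eq_left hi',
    wordFunctional_take]

theorem wordPairing_one : wordPairing (tensorOne : (m : ℕ) → ⨂[ℝ]^m F) = wordOne := by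
  funext w
  cases w with
  | nil =>
    rw [wordPairing, wordFunctional]
    exact (tensorFunctional_tprod _ _).trans (by simp [wordOne])
  | cons a w => simp [wordPairing, tensorOne, wordOne]

theorem wordPairing_exp (v : F) : wordPairing (tensorExp v) = wordExp fun ℓ => ℓ v := by
  funext w
  rw [wordPairing, tensorExp, map_smul, wordFunctional, tensorFunctional_tprod, wordExp,
    smul_eq_mul]
  congr 1
  rw [← List.prod_ofFn]
  congr 1
  refine List.ext_getElem (by simp) fun i h1 h2 => ?_
  simp

theorem wordPairing_signatureSeq {T : ℕ} {E : Type u} [NormedAddCommGroup E] [NormedSpace ℝ E]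
    (x : Fin (T + 1) → E) :
    wordPairing (signatureSeq x) =
      wordSig (List.ofFn fun t (ℓ : StrongDual ℝ (TimeExt E)) => ℓ (timeIncrement x t)) := by
  have key : ∀ l : List (TimeExt E),
      wordPairing ((l.map tensorExp).foldr tensorConv tensorOne) =
        wordSig (l.map fun v (ℓ : StrongDual ℝ (TimeExt E)) => ℓ v) := by
    intro l
    induction l with
    | nil => exact wordPairing_one
    | cons v l ih =>
      rw [List.map_cons, List.foldr_cons, wordPairing_conv, ih, wordPairing_exp]
      rfl
  have h := key (List.ofFn (timeIncrement x))
  rwa [List.map_ofFn, List.map_ofFn] at h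

/-- A path is determined by the pairings of its signature with words. -/
theorem eq_of_wordPairing_signatureSeq_eq {T : ℕ} {E : Type u} [NormedAddCommGroup E]
    [NormedSpace ℝ E] {x y : Fin (T + 1) → E}
    (h : wordPairing (signatureSeq x) = wordPairing (signatureSeq y)) : x = y := by
  rw [wordPairing_signatureSeq, wordPairing_signatureSeq] at h
  -- The time coordinate serves as the letter `τ`: it equals `1` on every increment, the initial one
  -- included.
  have hτ : ∀ z : Fin (T + 1) → E, ∀ c ∈ List.ofFn fun t (ℓ : StrongDual ℝ (TimeExt E)) =>
      ℓ (timeIncrement z t), c (WithLp.fstL 1 ℝ ℝ E) = 1 := by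
    intro z c hc
    obtain ⟨t, rfl⟩ := List.mem_ofFn.1 hc
    rfl
  have hinc : timeIncrement x = timeIncrement y := by
    funext t
    -- By Hahn–Banach it suffices to test increments with functionals. Since `Δ₀x` contains `x 0`,
    -- the increments then give back the path.
    refine (SeparatingDual.eq_iff_forall_dual_eq (R := ℝ)).2 fun ℓ => ?_
    have := map_apply_eq_of_wordSig_eq (by simp) (hτ x) (hτ y) h ℓ
    rw [List.map_ofFn, List.map_ofFn] at this
    exact congrFun (List.ofFn_injective this) t
  have hsnd : ∀ t, (timeIncrement x t).snd = (timeIncrement y t).snd := fun t => by rw [hinc]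
  funext t
  induction t using Fin.induction with
  | zero => exact hsnd 0
  | succ s ih =>
    have h1 : x s.succ - x s.castSucc = y s.succ - y s.castSucc := hsnd s.succ
    rw [ih] at h1
    exact sub_left_injective h1

/-- The pairing with the word consisting of the time functional. -/
theorem wordPairing_signatureSeq_time {T : ℕ} {E : Type u} [NormedAddCommGroup E]
    [NormedSpace ℝ E] (x : Fin (T + 1) → E) :
    wordPairing (signatureSeq x) [WithLp.fstL 1 ℝ ℝ E] = T + 1 := by
  have h := wordSig_replicate (τ := WithLp.fstL 1 ℝ ℝ E)
    (l := List.ofFn fun t (ℓ : StrongDual ℝ (TimeExt E)) => ℓ (timeIncrement x t)) (by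
      intro c hc
      obtain ⟨t, rfl⟩ := List.mem_ofFn.1 hc
      rfl) 1
  rw [wordPairing_signatureSeq]
  simpa using h

end Pairing

/-! ### Continuity -/

section Continuity

variable {F : Type u} [NormedAddCommGroup F] [NormedSpace ℝ F] (N : AdmissibleNorm F)

/-- The tensor functionals are continuous on the normed tensor powers. -/
def wordFunctionalCLM (w : List (StrongDual ℝ F)) (m : ℕ) :
    StrongDual ℝ (NormedTensorPower N m) :=
  LinearMap.mkContinuousOfExistsBound (show NormedTensorPower N m →ₗ[ℝ] ℝ from wordFunctional w m)
    (N.continuous_functional m fun k => w.getD k 0)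

/-- The extension of the tensor functionals to the completed tensor powers. -/
def completedWordFunctional (w : List (StrongDual ℝ F)) (m : ℕ) :
    StrongDual ℝ (CompletedTensorPower N m) :=
  (wordFunctionalCLM N w m).extend
    (UniformSpace.Completion.toComplL (𝕜 := ℝ) (E := NormedTensorPower N m))

theorem completedWordFunctional_coe (w : List (StrongDual ℝ F)) (m : ℕ) (t : ⨂[ℝ]^m F) :
    completedWordFunctional N w m (toCompletedTensorPower N m t) = wordFunctional w m t :=
  ContinuousLinearMap.extend_eq (wordFunctionalCLM N w m)
    (e := UniformSpace.Completion.toComplL (𝕜 := ℝ) (E := NormedTensorPower N m))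
    UniformSpace.Completion.denseRange_coe
    (UniformSpace.Completion.isUniformInducing_coe (NormedTensorPower N m)) t

/-- The continuous functional on the completed tensor algebra given by a word. -/
def wordDual (w : List (StrongDual ℝ F)) : StrongDual ℝ (CompletedTensorAlgebra N) :=
  (completedWordFunctional N w w.length).comp
    (lp.evalCLM ℝ (fun m => CompletedTensorPower N m) 1 w.length)

theorem wordDual_apply (w : List (StrongDual ℝ F)) (s : CompletedTensorAlgebra N) :
    wordDual N w s = completedWordFunctional N w w.length (s w.length) := rfl

/-- Multiplication of tensors as a continuous bilinear map. -/
def tensorMulCLM (i j : ℕ) :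
    NormedTensorPower N i →L[ℝ] NormedTensorPower N j →L[ℝ] NormedTensorPower N (i + j) :=
  LinearMap.mkContinuous₂ (show NormedTensorPower N i →ₗ[ℝ] NormedTensorPower N j →ₗ[ℝ]
      NormedTensorPower N (i + j) from
      (TensorProduct.mk ℝ (⨂[ℝ]^i F) (⨂[ℝ]^j F)).compr₂ TensorPower.mulEquiv.toLinearMap) 1
    fun a b => by
      rw [one_mul]
      exact N.norm_mul_le i j a b

/-- Componentwise continuity of a family of tensor sequences. -/
def ComponentwiseContinuous {Z : Type*} [TopologicalSpace Z] (s : Z → (m : ℕ) → ⨂[ℝ]^m F) : Prop :=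
  ∀ m, Continuous fun z => (show NormedTensorPower N m from s z m)

variable {N} {Z : Type*} [TopologicalSpace Z]

theorem continuous_tensorMul {i j : ℕ} {a : Z → ⨂[ℝ]^i F} {b : Z → ⨂[ℝ]^j F}
    (ha : Continuous fun z => (show NormedTensorPower N i from a z))
    (hb : Continuous fun z => (show NormedTensorPower N j from b z)) :
    Continuous fun z => (show NormedTensorPower N (i + j) from
      GradedMonoid.GMul.mul (A := fun i => ⨂[ℝ]^i F) (a z) (b z)) :=
  ((tensorMulCLM N i j).continuous.comp ha).clm_apply hb

theorem continuous_tensorCast {i j : ℕ} (h : i = j) {a : Z → ⨂[ℝ]^i F}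
    (ha : Continuous fun z => (show NormedTensorPower N i from a z)) :
    Continuous fun z => (show NormedTensorPower N j from TensorPower.cast ℝ F h (a z)) := by
  subst h
  simpa using ha

theorem ComponentwiseContinuous.conv {s t : Z → (m : ℕ) → ⨂[ℝ]^m F}
    (hs : ComponentwiseContinuous N s) (ht : ComponentwiseContinuous N t) :
    ComponentwiseContinuous N fun z => tensorConv (s z) (t z) := fun m =>
  continuous_finsetSum (M := NormedTensorPower N m) _ fun p _ =>
    continuous_tensorCast _ (continuous_tensorMul (hs p.1.1) (ht p.1.2))

/-- Powers are built by multiplying with one factor at a time: the embedding in degree one preserves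
the norm, and multiplication is continuous by submultiplicativity. -/
theorem continuous_tensorPow {v : Z → F} (hv : Continuous v) (m : ℕ) :
    Continuous fun z => (show NormedTensorPower N m from
      PiTensorProduct.tprod ℝ fun _ : Fin m => v z) := by
  have h1 : Continuous fun z => (show NormedTensorPower N 1 from
      PiTensorProduct.tprod ℝ fun _ : Fin 1 => v z) := by
    have hu : ∀ v : F, Function.update (fun _ : Fin 1 => (0 : F)) 0 v = fun _ => v := fun v => by
      funext i
      rw [Subsingleton.elim i 0, Function.update_self]
    let ι : F →ₗ[ℝ] NormedTensorPower N 1 :=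
      { toFun := fun v => (show ⨂[ℝ]^1 F from PiTensorProduct.tprod ℝ fun _ : Fin 1 => v)
        map_add' := fun v w => by
          have := (PiTensorProduct.tprod ℝ (s := fun _ : Fin 1 => F)).map_update_add
            (fun _ => (0 : F)) 0 v w
          rwa [hu, hu, hu] at this
        map_smul' := fun c v => by
          have := (PiTensorProduct.tprod ℝ (s := fun _ : Fin 1 => F)).map_update_smul
            (fun _ => (0 : F)) 0 c v
          rwa [hu, hu] at this }
    exact (ι.mkContinuous 1 fun v => by rw [one_mul]; exact (N.norm_single v).le).continuous.comp hv
  induction m with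
  | zero =>
    have : (fun z => (PiTensorProduct.tprod ℝ fun _ : Fin 0 => v z)) =
        fun _ => PiTensorProduct.tprod ℝ Fin.elim0 := by
      funext z
      congr 1
      exact Subsingleton.elim _ _
    rw [this]
    exact continuous_const
  | succ m ih =>
    have h : (fun z => PiTensorProduct.tprod ℝ (fun _ : Fin (m + 1) => v z)) = fun z =>
        GradedMonoid.GMul.mul (A := fun i => ⨂[ℝ]^i F)
          (PiTensorProduct.tprod ℝ fun _ : Fin m => v z)
          (PiTensorProduct.tprod ℝ fun _ : Fin 1 => v z) := by
      funext z
      rw [TensorPower.tprod_mul_tprod]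
      congr 1
      funext i
      refine Fin.addCases (fun i => ?_) (fun i => ?_) i <;> simp
    rw [h]
    exact continuous_tensorMul ih h1

theorem componentwiseContinuous_exp {v : Z → F} (hv : Continuous v) :
    ComponentwiseContinuous N fun z => tensorExp (v z) := fun m =>
  (continuous_tensorPow (N := N) hv m).const_smul (m.factorial : ℝ)⁻¹

theorem componentwiseContinuous_prod_exp {n : ℕ} {v : Z → Fin n → F} (hv : Continuous v) :
    ComponentwiseContinuous N fun z =>
      (List.ofFn fun t => tensorExp (v z t)).foldr tensorConv tensorOne := by
  induction n with
  | zero => exact fun m => by simpa using continuous_const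
  | succ n ih =>
    have h : Continuous fun z (t : Fin n) => v z t.succ :=
      continuous_pi fun t => (continuous_apply t.succ).comp hv
    simp only [List.ofFn_succ, List.foldr_cons]
    exact (componentwiseContinuous_exp ((continuous_apply 0).comp hv)).conv (ih h)

theorem AdmissibleNorm.norm_conv_le (N : AdmissibleNorm F) {s t : (m : ℕ) → ⨂[ℝ]^m F} {a b : ℝ}
    (ha : 0 ≤ a) (hs : ∀ m, N.norm m (s m) ≤ a ^ m / m.factorial)
    (ht : ∀ m, N.norm m (t m) ≤ b ^ m / m.factorial)
    (m : ℕ) : N.norm m (tensorConv s t m) ≤ (a + b) ^ m / m.factorial := by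
  rw [tensorConv]
  refine (Finset.le_sum_of_subadditive (N.norm m) (map_zero (N.norm m)).le
    (map_add_le_add (N.norm m)) _ _).trans ?_
  have h1 : ∀ p ∈ (Finset.HasAntidiagonal.antidiagonal m).attach,
      N.norm m (TensorPower.cast ℝ F (Finset.HasAntidiagonal.mem_antidiagonal.1 p.2)
        (GradedMonoid.GMul.mul (A := fun i => ⨂[ℝ]^i F) (s p.1.1) (t p.1.2))) ≤
      a ^ p.1.1 / p.1.1.factorial * (b ^ p.1.2 / p.1.2.factorial) := fun p _ => by
    rw [N.norm_cast]
    exact (N.norm_mul_le _ _ _ _).trans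
      (mul_le_mul (hs _) (ht _) (apply_nonneg _ _) (by positivity))
  refine (Finset.sum_le_sum h1).trans (le_of_eq ?_)
  -- The bounds are the coefficients of `exp a` and `exp b`; their convolution is that of `exp (a +
  -- b)`.
  rw [Finset.sum_attach _ fun p : ℕ × ℕ => a ^ p.1 / p.1.factorial * (b ^ p.2 / p.2.factorial),
    Finset.Nat.sum_antidiagonal_eq_sum_range_succ fun i j =>
      a ^ i / i.factorial * (b ^ j / j.factorial), add_pow, Finset.sum_div]
  refine Finset.sum_congr rfl fun i hi => ?_
  have hi' : i ≤ m := Nat.lt_succ_iff.1 (Finset.mem_range.1 hi)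
  have hc : ((m.choose i : ℝ) * i.factorial * (m - i).factorial) = m.factorial := by
    exact_mod_cast Nat.choose_mul_factorial_mul_factorial hi'
  have hne : (m.choose i : ℝ) ≠ 0 := by exact_mod_cast (Nat.choose_pos hi').ne'
  rw [← hc]
  field_simp

theorem AdmissibleNorm.norm_exp_le (N : AdmissibleNorm F) (v : F) (m : ℕ) :
    N.norm m (tensorExp v m) ≤ ‖v‖ ^ m / m.factorial := by
  rw [tensorExp, map_smul_eq_mul, Real.norm_eq_abs, abs_of_nonneg (by positivity), div_eq_inv_mul]
  exact mul_le_mul_of_nonneg_left (N.norm_pow_le v m) (by positivity)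

theorem AdmissibleNorm.norm_prod_exp_le (N : AdmissibleNorm F) (l : List F) (m : ℕ) :
    N.norm m ((l.map tensorExp).foldr tensorConv tensorOne m) ≤
      (l.map fun v => ‖v‖).sum ^ m / m.factorial := by
  induction l generalizing m with
  | nil =>
    cases m with
    | zero => simpa [tensorOne] using N.norm_unit.le
    | succ m => simp [tensorOne]
  | cons v l ih =>
    simp only [List.map_cons, List.foldr_cons, List.sum_cons]
    exact N.norm_conv_le (norm_nonneg v) (N.norm_exp_le v) ih m

theorem lp_one_norm_eq_tsum {ι : Type*} {G : ι → Type*} [∀ i, NormedAddCommGroup (G i)]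
    (f : lp G 1) : ‖f‖ = ∑' i, ‖f i‖ := by
  simp [lp.norm_eq_tsum_rpow (p := 1) (by simp) f]

/-- Componentwise continuity and local domination give continuity into `ℓ¹`. -/
theorem continuousAt_lp_one {ι : Type*} {G : ι → Type*} [∀ i, NormedAddCommGroup (G i)]
    {f : Z → lp G 1} {z₀ : Z} (hf : ∀ i, ContinuousAt (fun z => f z i) z₀) {b : ι → ℝ}
    (hb : Summable b) (hfb : ∀ᶠ z in 𝓝 z₀, ∀ i, ‖f z i‖ ≤ b i) : ContinuousAt f z₀ := by
  rw [ContinuousAt, tendsto_iff_norm_sub_tendsto_zero]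
  simp_rw [lp_one_norm_eq_tsum]
  have h0 : (0 : ℝ) = ∑' _ : ι, (0 : ℝ) := by simp
  rw [h0]
  -- The bound `b` also holds at `z₀` itself, so twice `b` dominates the differences.
  refine tendsto_tsum_of_dominated_convergence (bound := fun i => b i + b i) (hb.add hb)
    (fun i => ?_) ?_
  · have := (hf i).tendsto
    rw [tendsto_iff_norm_sub_tendsto_zero] at this
    exact this
  · filter_upwards [hfb] with z hz i
    rw [norm_norm]
    exact (norm_sub_le _ _).trans (add_le_add (hz i) (hfb.self_of_nhds i))

theorem continuous_timeIncrement {T : ℕ} {E : Type*} [NormedAddCommGroup E] :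
    Continuous fun x : Fin (T + 1) → E => timeIncrement x := by
  refine continuous_pi fun t => (WithLp.prod_continuous_toLp 1 ℝ E).comp
    (continuous_const.prodMk ?_)
  induction t using Fin.cases with
  | zero => exact continuous_apply 0
  | succ s => exact (continuous_apply s.succ).sub (continuous_apply s.castSucc)

theorem continuous_signature {T : ℕ} {E : Type u} [NormedAddCommGroup E] [NormedSpace ℝ E]
    (N : AdmissibleNorm (TimeExt E)) :
    Continuous fun x : Fin (T + 1) → E => signature N x := by
  refine continuous_iff_continuousAt.2 fun x₀ => ?_
  let R : (Fin (T + 1) → E) → ℝ := fun x => ((List.ofFn (timeIncrement x)).map fun v => ‖v‖).sum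
  have hR : Continuous R := by
    have : R = fun x => ∑ t, ‖timeIncrement x t‖ := by
      funext x
      simp only [R, List.map_ofFn, List.sum_ofFn, Function.comp_apply]
    rw [this]
    exact continuous_finsetSum _ fun t _ =>
      ((continuous_apply t).comp continuous_timeIncrement).norm
  -- `R` is the variation of the time-extended path. It bounds the degree `m` component by `R x ^ m
  -- / m!`, and near `x₀` it stays below `R x₀ + 1`.
  refine continuousAt_lp_one (b := fun m => (R x₀ + 1) ^ m / m.factorial) (fun m => ?_)
    (Real.summable_pow_div_factorial _) ?_
  · exact ((UniformSpace.Completion.continuous_coe (NormedTensorPower N m)).comp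
      (componentwiseContinuous_prod_exp (N := N) continuous_timeIncrement m)).continuousAt
  · filter_upwards [hR.continuousAt.eventually (gt_mem_nhds (lt_add_one (R x₀)))] with x hx m
    change ‖toCompletedTensorPower N m (signatureSeq x m)‖ ≤ _
    rw [norm_toCompletedTensorPower]
    have h := N.norm_prod_exp_le (List.ofFn (timeIncrement x)) m
    rw [List.map_ofFn] at h
    refine h.trans ?_
    have hR0 : 0 ≤ R x := List.sum_nonneg (by simp)
    change R x ^ m / _ ≤ _
    gcongr

end Continuity

/-! ### Robust signatures determine measures on path space -/

section PathInclusion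

variable {E : Type u} [NormedAddCommGroup E]

/-- The inclusion of paths in a subset into all paths. -/
def pathInclusion (T : ℕ) (W : Set E) : C(Fin (T + 1) → W, Fin (T + 1) → E) :=
  ⟨fun y t => y t, by fun_prop⟩

/-- `E` is not assumed separable, so coordinatewise measurability would not suffice directly. The
range of `s` is separable, and the map factors through paths in its closure. -/
theorem stronglyMeasurable_path_comp {T : ℕ} {R : Type*} [MeasurableSpace R] {s : R → E}
    (hs : StronglyMeasurable s) :
    StronglyMeasurable fun (x : Fin (T + 1) → R) t => s (x t) := by
  let : MeasurableSpace E := borel E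
  have : BorelSpace E := ⟨rfl⟩
  have := hs.isSeparable_range.closure.separableSpace
  have := UniformSpace.secondCountable_of_separable (closure (range s))
  let j : (Fin (T + 1) → R) → Fin (T + 1) → closure (range s) := fun x t =>
    ⟨s (x t), subset_closure (mem_range_self _)⟩
  have hj : Measurable j := measurable_pi_lambda _ fun t =>
    (hs.measurable.comp (measurable_pi_apply t)).subtype_mk
  exact (pathInclusion T (closure (range s))).continuous.comp_stronglyMeasurable
    hj.stronglyMeasurable

end PathInclusion

section RobustSignature

theorem tensorConv_zero {F : Type*} [AddCommGroup F] [Module ℝ F] {s t : (m : ℕ) → ⨂[ℝ]^m F}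
    (hs : s 0 = PiTensorProduct.tprod ℝ Fin.elim0) (ht : t 0 = PiTensorProduct.tprod ℝ Fin.elim0) :
    tensorConv s t 0 = PiTensorProduct.tprod ℝ Fin.elim0 := by
  have h0 : ((0, 0) : ℕ × ℕ) ∈ Finset.HasAntidiagonal.antidiagonal 0 := by simp
  rw [tensorConv, Finset.sum_eq_single_of_mem ⟨(0, 0), h0⟩ (Finset.mem_attach _ _)
    fun p _ hp => absurd (Subtype.ext (by simpa using p.2)) hp]
  simp only [hs, ht]
  rw [TensorPower.tprod_mul_tprod, TensorPower.cast_tprod]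
  congr 1
  exact Subsingleton.elim _ _

variable {T : ℕ} {E : Type u} [NormedAddCommGroup E] [NormedSpace ℝ E]

theorem signatureSeq_zero (x : Fin (T + 1) → E) :
    signatureSeq x 0 = PiTensorProduct.tprod ℝ Fin.elim0 := by
  have key : ∀ l : List (TimeExt E), (l.map tensorExp).foldr tensorConv tensorOne 0 =
      PiTensorProduct.tprod ℝ Fin.elim0 := by
    intro l
    induction l with
    | nil => rfl
    | cons v l ih =>
      refine tensorConv_zero ?_ ih
      rw [tensorExp, Nat.factorial_zero, Nat.cast_one, inv_one, one_smul]
      congr 1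
      exact Subsingleton.elim _ _
  have h := key (List.ofFn (timeIncrement x))
  rwa [List.map_ofFn] at h

variable {N : AdmissibleNorm (TimeExt E)} (L : TensorNormalization N)

theorem signature_mem_unitScalarPart (N : AdmissibleNorm (TimeExt E)) (x : Fin (T + 1) → E) :
    signature N x ∈ unitScalarPart N :=
  congrArg (toCompletedTensorPower N 0) (signatureSeq_zero x)

/-- The robust (normalized) signature of a path. -/
def robustSignature (x : Fin (T + 1) → E) : CompletedTensorAlgebra N := L.toFun (signature N x)

theorem continuous_robustSignature :
    Continuous (robustSignature L : (Fin (T + 1) → E) → CompletedTensorAlgebra N) :=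
  L.continuousOn.comp_continuous (continuous_signature N) (signature_mem_unitScalarPart N)

theorem exists_norm_robustSignature_le :
    ∃ K : ℝ, ∀ x : Fin (T + 1) → E, ‖robustSignature L x‖ ≤ K := by
  obtain ⟨K, hK⟩ := L.bounded
  exact ⟨K, fun x => hK _ (signature_mem_unitScalarPart N x)⟩

theorem wordDual_robustSignature (w : List (StrongDual ℝ (TimeExt E))) (x : Fin (T + 1) → E) :
    wordDual N w (robustSignature L x) =
      L.scale (signature N x) ^ w.length * wordPairing (signatureSeq x) w := by
  rw [wordDual_apply, robustSignature, L.apply_eq _ (signature_mem_unitScalarPart N x), map_smul,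
    smul_eq_mul]
  congr 1
  exact completedWordFunctional_coe N w w.length (signatureSeq x w.length)

theorem isShuffleCharacter_wordDual_robustSignature (x : Fin (T + 1) → E) :
    IsShuffleCharacter fun w => wordDual N w (robustSignature L x) := by
  simp only [wordDual_robustSignature]
  refine IsShuffleCharacter.dilate ?_ _
  rw [wordPairing_signatureSeq]
  exact isShuffleCharacter_wordSig _

theorem eq_of_forall_wordDual_robustSignature_eq {x y : Fin (T + 1) → E}
    (h : ∀ w, wordDual N w (robustSignature L x) = wordDual N w (robustSignature L y)) : x = y := by
  simp only [wordDual_robustSignature] at h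
  -- The time word of length one has the value `T + 1` on every unnormalized signature, so its
  -- normalized value reveals the scale.
  have hs : L.scale (signature N x) = L.scale (signature N y) := by
    have h1 := h [WithLp.fstL 1 ℝ ℝ E]
    rw [wordPairing_signatureSeq_time, wordPairing_signatureSeq_time, List.length_singleton,
      pow_one, pow_one] at h1
    exact mul_right_cancel₀ (by positivity) h1
  refine eq_of_wordPairing_signatureSeq_eq (funext fun w => ?_)
  have hw := h w
  rw [hs] at hw
  exact mul_left_cancel₀
    (pow_ne_zero _ (L.scale_pos _ (signature_mem_unitScalarPart N y)).ne') hw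

variable {Z : Type*} [TopologicalSpace Z]

/-- The bounded continuous function given by a word, along a continuous family of paths. -/
def wordBCF (φ : C(Z, Fin (T + 1) → E)) (w : List (StrongDual ℝ (TimeExt E))) : Z →ᵇ ℝ :=
  BoundedContinuousFunction.ofNormedAddCommGroup
    (fun z => wordDual N w (robustSignature L (φ z)))
    ((wordDual N w).continuous.comp ((continuous_robustSignature L).comp φ.continuous))
    (‖wordDual N w‖ * (exists_norm_robustSignature_le (T := T) L).choose)
    fun _ => ((wordDual N w).le_opNorm _).trans (mul_le_mul_of_nonneg_left
      ((exists_norm_robustSignature_le (T := T) L).choose_spec _) (norm_nonneg _))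

theorem wordBCF_nil (φ : C(Z, Fin (T + 1) → E)) : wordBCF L φ [] = 1 := by
  ext z
  exact (isShuffleCharacter_wordDual_robustSignature L (φ z)).nil

theorem wordBCF_mul (φ : C(Z, Fin (T + 1) → E)) (p q : List (StrongDual ℝ (TimeExt E))) :
    wordBCF L φ p * wordBCF L φ q = shuffleSum (wordBCF L φ) p q := by
  ext z
  let e : (Z →ᵇ ℝ) →+ ℝ :=
    { toFun := fun f => f z, map_zero' := rfl, map_add' := fun _ _ => rfl }
  exact ((isShuffleCharacter_wordDual_robustSignature L (φ z)).mul p q).trans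
    (map_shuffleSum e (wordBCF L φ) p q).symm

/-- The algebra of linear functionals of the robust signature. -/
def wordAlgebra (φ : C(Z, Fin (T + 1) → E)) : StarSubalgebra ℝ (Z →ᵇ ℝ) where
  toSubalgebra := (Submodule.span ℝ (range (wordBCF L φ))).toSubalgebra
    (wordBCF_nil L φ ▸ Submodule.subset_span (mem_range_self _)) (by
      intro f g hf hg
      -- It suffices to multiply two words, and their product is a sum of words over shuffles.
      have h := Submodule.mul_mem_mul hf hg
      rw [Submodule.span_mul_span] at h
      refine Submodule.span_le.2 ?_ h
      rintro _ ⟨_, ⟨p, rfl⟩, _, ⟨q, rfl⟩, rfl⟩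
      change wordBCF L φ p * wordBCF L φ q ∈ _
      rw [wordBCF_mul]
      exact shuffleSum_mem _ (fun w => Submodule.subset_span (mem_range_self w)) p q)
  star_mem' := by
    intro f hf
    rwa [show star f = f from BoundedContinuousFunction.ext fun z => rfl]

theorem mem_wordAlgebra {φ : C(Z, Fin (T + 1) → E)} {f : Z →ᵇ ℝ} :
    f ∈ wordAlgebra L φ ↔ f ∈ Submodule.span ℝ (range (wordBCF L φ)) := Iff.rfl

/-- The normalization makes the word functions bounded, so their span is a unital algebra of bounded
continuous functions; it separates points because `φ` is injective. Such an algebra determines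
finite measures on a Polish space. -/
theorem measure_ext_of_integral_wordDual [PolishSpace Z] [MeasurableSpace Z] [BorelSpace Z]
    {φ : C(Z, Fin (T + 1) → E)} (hφ : Function.Injective φ) {μ ν : Measure Z} [IsFiniteMeasure μ]
    [IsFiniteMeasure ν]
    (h : ∀ w, ∫ z, wordDual N w (robustSignature L (φ z)) ∂μ =
      ∫ z, wordDual N w (robustSignature L (φ z)) ∂ν) : μ = ν := by
  refine ext_of_forall_mem_subalgebra_integral_eq_of_polish (𝕜 := ℝ) (A := wordAlgebra L φ) ?_ ?_
  · intro x y hxy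
    by_contra hcon
    push Not at hcon
    refine hxy (hφ (eq_of_forall_wordDual_robustSignature_eq L fun w => ?_))
    exact hcon _ ⟨_, ⟨wordBCF L φ w, Submodule.subset_span (mem_range_self w), rfl⟩, rfl⟩
  · intro g hg
    rw [mem_wordAlgebra] at hg
    induction hg using Submodule.span_induction with
    | mem f hf =>
      obtain ⟨w, rfl⟩ := hf
      exact h w
    | zero => simp
    | add f g _ _ hf hg =>
      simp only [BoundedContinuousFunction.coe_add, Pi.add_apply]
      rw [integral_add (f.integrable μ) (g.integrable μ),
        integral_add (f.integrable ν) (g.integrable ν), hf, hg]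
    | smul c f _ hf =>
      simp only [BoundedContinuousFunction.coe_smul]
      rw [integral_smul, integral_smul, hf]

variable {R : Type*} [MeasurableSpace R] {s : R → E}

theorem stronglyMeasurable_robustSignature_comp (hs : StronglyMeasurable s) :
    StronglyMeasurable fun x : Fin (T + 1) → R => robustSignature L fun t => s (x t) :=
  (continuous_robustSignature L).comp_stronglyMeasurable (stronglyMeasurable_path_comp hs)

/-- The measures are pushed forward to paths in the closure of the range of `s`, a Polish space
because the range is separable and `E` complete. No information is lost: an injective measurable map
out of a standard Borel space is a measurable embedding. -/
theorem measure_ext_of_integral_robustSignature [CompleteSpace E] [StandardBorelSpace R]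
    (hs : StronglyMeasurable s) (hinj : Function.Injective s) {μ ν : Measure (Fin (T + 1) → R)}
    [IsFiniteMeasure μ] [IsFiniteMeasure ν]
    (h : ∫ x, robustSignature L (fun t => s (x t)) ∂μ =
      ∫ x, robustSignature L (fun t => s (x t)) ∂ν) : μ = ν := by
  let : MeasurableSpace E := borel E
  have : BorelSpace E := ⟨rfl⟩
  have := hs.isSeparable_range.closure.separableSpace
  have := UniformSpace.secondCountable_of_separable (closure (range s))
  have : CompleteSpace (closure (range s)) := isClosed_closure.completeSpace_coe
  have hF := stronglyMeasurable_robustSignature_comp (T := T) L hs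
  obtain ⟨K, hK⟩ := exists_norm_robustSignature_le (T := T) L
  have hint : ∀ ρ : Measure (Fin (T + 1) → R), IsFiniteMeasure ρ →
      Integrable (fun x => robustSignature L fun t => s (x t)) ρ := fun ρ _ =>
    Integrable.of_bound hF.aestronglyMeasurable K (Eventually.of_forall fun x => hK _)
  let j : (Fin (T + 1) → R) → Fin (T + 1) → closure (range s) := fun x t =>
    ⟨s (x t), subset_closure (mem_range_self _)⟩
  have hj : Measurable j := measurable_pi_lambda _ fun t =>
    (hs.measurable.comp (measurable_pi_apply t)).subtype_mk
  have hjinj : Function.Injective j := fun x y hxy =>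
    funext fun t => hinj (congrArg Subtype.val (congrFun hxy t))
  refine (hj.measurableEmbedding hjinj).map_injective ?_
  refine measure_ext_of_integral_wordDual L (φ := pathInclusion T (closure (range s)))
    (fun x y hxy => funext fun t => Subtype.ext (congrFun hxy t)) fun w => ?_
  -- Continuous functionals commute with the Bochner integral, so the expected signature contains
  -- the integrals of all word functions.
  have hmap : ∀ ρ : Measure (Fin (T + 1) → R), IsFiniteMeasure ρ →
      ∫ z, wordDual N w (robustSignature L (pathInclusion T (closure (range s)) z)) ∂(ρ.map j) =
        wordDual N w (∫ x, robustSignature L (fun t => s (x t)) ∂ρ) := fun ρ hρ => by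
    rw [← ContinuousLinearMap.integral_comp_comm _ (hint ρ hρ)]
    exact integral_map hj.aemeasurable (wordBCF L (pathInclusion T (closure (range s)))
      w).continuous.aestronglyMeasurable
  rw [hmap μ inferInstance, hmap ν inferInstance, h]

end RobustSignature

/-! ### Robust expected signatures of higher rank -/

section RobustExpSig

variable {T : ℕ} {V : Type u} [NormedAddCommGroup V] [NormedSpace ℝ V] [CompleteSpace V]
  [TopologicalSpace.SeparableSpace V] [MeasurableSpace V] [BorelSpace V]
  {N : TensorNormSystem.{u}} (L : RankNormalization N V)

theorem stronglyMeasurable_robustExpSig (r : ℕ) :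
    StronglyMeasurable (robustExpSig L r : RankProb T V r → RankTensor N V r) := by
  induction r with
  | zero =>
    have := UniformSpace.secondCountable_of_separable V
    exact (stronglyMeasurable_id : StronglyMeasurable (id : V → V))
  | succ r ih =>
    exact RankProb.stronglyMeasurable_integral
      (E := CompletedTensorAlgebra (N (TimeExt (RankTensor N V r))))
      (stronglyMeasurable_robustSignature_comp (T := T) (L r) ih)

/-- Injectivity at rank `r` is what lets a measure on paths in `Prob_r` be recovered from its image
on paths of tensors, which gives rank `r + 1`. -/
theorem robustExpSig_injective (r : ℕ) :
    Function.Injective (robustExpSig L r : RankProb T V r → RankTensor N V r) := by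
  induction r with
  | zero => exact fun x y h => h
  | succ r ih =>
    intro μ ν h
    exact RankProb.toMeasure_injective (measure_ext_of_integral_robustSignature (L r)
      (stronglyMeasurable_robustExpSig L r) ih h)

end RobustExpSig

end

theorem theorem4p4 {V : Type u} [NormedAddCommGroup V] [NormedSpace ℝ V] [CompleteSpace V]
    [TopologicalSpace.SeparableSpace V] [MeasurableSpace V] [BorelSpace V]
    (N : TensorNormSystem.{u}) (L : RankNormalization N V) (T : ℕ)
    (X : AdaptedProcess.{u, v} T V) (Y : AdaptedProcess.{u, w} T V) (r : ℕ) :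
    List.TFAE [
      ∀ f : AdaptedFunctional T V, f.rank ≤ r →
        ∫ ω, f.eval X ω ∂X.P = ∫ ω, f.eval Y ω ∂Y.P,
      X.predictionLaw r = Y.predictionLaw r,
      X.jointPredictionLaw r = Y.jointPredictionLaw r,
      adaptedSig L r X = adaptedSig L r Y] := by
  tfae_have 1 ↔ 2 := forall_integral_eval_eq_iff_predictionLaw_eq X Y r
  tfae_have 3 ↔ 2 := jointPredictionLaw_eq_iff
  tfae_have 4 ↔ 2 := (robustExpSig_injective L (r + 1)).eq_iff
  tfae_finish
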